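/- Let $1\le p\le q$, and let $\mathrm{Gr}_{p,q}$ be the Grassmannian of $p$-dimensional linear subspaces of the Euclidean space $\mathbb R^{p+q}$. For $L,M\in\mathrm{Gr}_{p,q}$ with orthonormal bases $e_1,\dots,e_p$ of $L$ and $f_1,\dots,f_p$ of $M$, let $\lambda_1\ge\dots\ge\lambda_p$ be the singular values of the $p\times p$ matrix $(\langle e_i,f_j\rangle)$ (they do not depend on the choice of the bases), and let $\Psi_j[L,M]=\arccos\lambda_j\in[0,\pi/2]$, $j=1,\dots,p$, be the Jordan angles between $L$ and $M$. Identify the tangent space of $\mathrm{Gr}_{p,q}$ at $L$ with the space of linear operators $H:L\to L^\perp$, and let $\rho_1[L;H]\le\dots\le\rho_p[L;H]$ be the singular values of $H$, that is, the square roots of the eigenvalues of $H^*H:L\to L$. Let $\ell$ be a norm on $\mathbb R^p$ that is invariant under all permutations of the coordinates and all changes of signs of the coordinates. Consider the $\mathrm O(p+q)$-invariant Finsler metric on $\mathrm{Gr}_{p,q}$ given by $$F(L,H)=\ell(\rho_1[L;H],\dots,\rho_p[L;H]).$$ Then the associated geodesic distance, that is, the infimum of the lengths $\int_0^1F(\gamma(t),\gamma'(t))\,dt$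 over all piecewise continuously differentiable curves $\gamma:[0,1]\to\mathrm{Gr}_{p,q}$ with $\gamma(0)=L$ and $\gamma(1)=M$ (such curves exist), is equal to $$\ell(\Psi_1[L,M],\dots,\Psi_p[L,M])$$ for all $L,M\in\mathrm{Gr}_{p,q}$. -/

import Mathlib

open Set Filter Topology Module
open scoped RealInnerProductSpace

/-- The space `ℝ^{p+q}` with its standard scalar product. -/
abbrev AmbientSpace (p q : ℕ) : Type := EuclideanSpace ℝ (Fin (p + q))

/-- The Grassmannian `Gr_{p,q}`: the set of all `p`-dimensional linear subspaces of `ℝ^{p+q}`. -/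
def Gr (p q : ℕ) : Type := {L : Submodule ℝ (AmbientSpace p q) // finrank ℝ L = p}

/-- A norm `ℓ` on `ℝ^p` which is invariant under the Weyl group `W_p`, the group generated by the
permutations of the coordinates and by the sign changes of the coordinates. -/
structure IsWeylInvariantNorm {p : ℕ} (ℓ : (Fin p → ℝ) → ℝ) : Prop where
  add_le : ∀ x y, ℓ (x + y) ≤ ℓ x + ℓ y
  smul : ∀ (c : ℝ) (x), ℓ (c • x) = |c| * ℓ x
  eq_zero : ∀ x, ℓ x = 0 → x = 0
  perm : ∀ (σ : Equiv.Perm (Fin p)) (x), ℓ (x ∘ σ) = ℓ x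
  sign : ∀ (ε : Fin p → ℤˣ) (x : Fin p → ℝ), ℓ (fun i => ((ε i : ℤ) : ℝ) * x i) = ℓ x

namespace Gr

variable {p q : ℕ}

/-- An orthonormal basis `e_1, …, e_p` of `L ∈ Gr_{p,q}`. -/
noncomputable def basis (L : Gr p q) : OrthonormalBasis (Fin p) ℝ L.1 :=
  (stdOrthonormalBasis ℝ L.1).reindex (finCongr L.2)

/-- The matrix `Λ[L,M]` with the matrix elements `⟨e_i, f_j⟩`, where `e` and `f` are orthonormal
bases of `L` and of `M`. -/
noncomputable def gramMatrix (L M : Gr p q) : Matrix (Fin p) (Fin p) ℝ :=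
  Matrix.of fun i j => ⟪(L.basis i : AmbientSpace p q), (M.basis j : AmbientSpace p q)⟫

/-- The singular values `λ_1 ≥ … ≥ λ_p` of the matrix `Λ[L,M]` (indexed from `0`). -/
noncomputable def cosAngle (L M : Gr p q) (j : Fin p) : ℝ :=
  (Matrix.toEuclideanLin (gramMatrix L M)).singularValues j

/-- The Jordan angles `Ψ_1[L,M] ≤ … ≤ Ψ_p[L,M]`, `Ψ_j = arccos λ_j`. -/
noncomputable def angle (L M : Gr p q) (j : Fin p) : ℝ :=
  Real.arccos (cosAngle L M j)

/-- The tangent space to the Grassmannian at `L`: the space of operators `H : L → L^⊥`. -/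
abbrev Tangent (L : Gr p q) : Type := L.1 →L[ℝ] L.1ᗮ

/-- The singular values `ρ_1[L;H] ≤ … ≤ ρ_p[L;H]` of a tangent vector `H : L → L^⊥`, in increasing
order. (Mathlib lists the singular values in decreasing order; the first `p = dim L` of them are
the square roots of the `p` eigenvalues of `H^* H`.) -/
noncomputable def rho (L : Gr p q) (H : Tangent L) (j : Fin p) : ℝ :=
  (H : L.1 →ₗ[ℝ] L.1ᗮ).singularValues (Fin.rev j)

/-- The Finsler metric `F(L,H) = ℓ(ρ_1[L;H], …, ρ_p[L;H])`. -/
noncomputable def finsler (ℓ : (Fin p → ℝ) → ℝ) (L : Gr p q) (H : Tangent L) : ℝ :=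
  ℓ (rho L H)

/-- The orthogonal projector `Π_L` of `ℝ^{p+q}` onto `L`. The map `L ↦ Π_L` is the standard
embedding of the Grassmannian into the space of operators, and it defines the manifold structure
of the Grassmannian. -/
noncomputable def proj (L : Gr p q) : AmbientSpace p q →L[ℝ] AmbientSpace p q :=
  L.1.starProjection

/-- The velocity `γ'(t) ∈ T_{γ(t)}` of a curve in the Grassmannian, as an operator `L → L^⊥`, where
`L = γ(t)`: it takes `x ∈ L` to the component in `L^⊥` of `(d/dt) Π_{γ(t)} x`. -/
noncomputable def velocity (γ : ℝ → Gr p q) (t : ℝ) : Tangent (γ t) :=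
  (γ t).1ᗮ.orthogonalProjectionOnto ∘L deriv (fun s => (γ s).proj) t ∘L (γ t).1.subtypeL

/-- The velocity is the tangent vector given by the usual identification of the tangent space with
the operators `L → L^⊥`: if near the time `t` the subspace `γ(s)` is the graph of an operator
`A(s)` from `L = γ(t)` to `L^⊥`, then `γ'(t) = A'(t)`. -/
theorem velocity_eq_of_graph (γ : ℝ → Gr p q) (t : ℝ) (A : ℝ → Tangent (γ t)) (H : Tangent (γ t))
    (hγ : DifferentiableAt ℝ (fun s => (γ s).proj) t)
    (hA : ∀ᶠ s in 𝓝 t, ∀ v, v ∈ (γ s).1 ↔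
      ∃ x : (γ t).1, v = (x : AmbientSpace p q) + (A s x : AmbientSpace p q))
    (hH : HasDerivAt A H t) : velocity γ t = H := by
  have key : ∀ x : (γ t).1, deriv (fun s => (γ s).proj) t (x : AmbientSpace p q)
      + (γ t).proj (H x : AmbientSpace p q) = (H x : AmbientSpace p q) := by
    intro x
    have hAx : HasDerivAt (fun s => (x : AmbientSpace p q) + (A s x : AmbientSpace p q))
        (H x : AmbientSpace p q) t := by
      have h1 : HasDerivAt (fun s => A s x) (H x) t := by
        simpa using hH.clm_apply (hasDerivAt_const t x)
      have h2 := ((γ t).1ᗮ.subtypeL.hasFDerivAt.comp_hasDerivAt t h1).const_add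
        (x : AmbientSpace p q)
      exact h2
    have hP := hγ.hasDerivAt.clm_apply hAx
    have heq : (fun s => (γ s).proj ((x : AmbientSpace p q) + (A s x : AmbientSpace p q)))
        =ᶠ[𝓝 t] fun s => (x : AmbientSpace p q) + (A s x : AmbientSpace p q) := by
      filter_upwards [hA] with s hs
      exact Submodule.starProjection_eq_self_iff.mpr ((hs _).mpr ⟨x, rfl⟩)
    have h3 := (hP.congr_of_eventuallyEq heq.symm).unique hAx
    have hAt : (A t x : AmbientSpace p q) = 0 := by
      have hmem : (x : AmbientSpace p q) + (A t x : AmbientSpace p q) ∈ (γ t).1 :=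
        (hA.self_of_nhds _).mpr ⟨x, rfl⟩
      have h4 : (A t x : AmbientSpace p q) ∈ (γ t).1 := by
        simpa using (γ t).1.sub_mem hmem x.2
      exact Submodule.disjoint_def.mp (γ t).1.orthogonal_disjoint _ h4 (A t x).2
    rw [hAt, add_zero] at h3
    exact h3
  ext1 x
  apply Subtype.ext
  have hz : (γ t).proj (H x : AmbientSpace p q) = 0 :=
    (Submodule.starProjection_apply_eq_zero_iff (γ t).1).mpr (H x).2
  have hk := key x
  rw [hz, add_zero] at hk
  change (((γ t).1ᗮ.orthogonalProjectionOnto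
    (deriv (fun s => (γ s).proj) t (x : AmbientSpace p q)) : (γ t).1ᗮ) : AmbientSpace p q) = _
  rw [hk, Submodule.orthogonalProjectionOnto_mem_subspace_eq_self]

/-- `γ` restricted to `[0,1]` is a piecewise continuously differentiable curve from `L` to `M`:
there is a subdivision `0 = τ_0 < τ_1 < ⋯ < τ_n = 1` such that `γ` is continuously differentiable
on every closed interval `[τ_i, τ_{i+1}]` (one-sidedly at its ends). -/
def IsPiecewiseC1Curve (γ : ℝ → Gr p q) (L M : Gr p q) : Prop :=
  γ 0 = L ∧ γ 1 = M ∧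
    ∃ (n : ℕ) (τ : Fin (n + 1) → ℝ), StrictMono τ ∧ τ 0 = 0 ∧ τ (Fin.last n) = 1 ∧
      ∀ i : Fin n, ContDiffOn ℝ 1 (fun s => (γ s).proj) (Icc (τ i.castSucc) (τ i.succ))

/-- The length `∫_0^1 F(γ(t), γ'(t)) dt` of a curve. For a piecewise continuously differentiable
curve the velocity exists outside of a finite set of times. -/
noncomputable def finslerLength (ℓ : (Fin p → ℝ) → ℝ) (γ : ℝ → Gr p q) : ℝ :=
  ∫ t in (0 : ℝ)..1, finsler ℓ (γ t) (velocity γ t)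

/-- The set of the lengths of all piecewise continuously differentiable curves from `L` to `M`. -/
def curveLengths (ℓ : (Fin p → ℝ) → ℝ) (L M : Gr p q) : Set ℝ :=
  {r | ∃ γ : ℝ → Gr p q, IsPiecewiseC1Curve γ L M ∧ finslerLength ℓ γ = r}

/-- The geodesic distance associated with the Finsler metric: the infimum of the lengths of the
curves from `L` to `M`. -/
noncomputable def geodesicDist (ℓ : (Fin p → ℝ) → ℝ) (L M : Gr p q) : ℝ :=
  sInf (curveLengths ℓ L M)

end Gr

/-! Upper bound. Right singular vectors of the projection from `M` to `L` give orthonormal vectors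
of `M` whose projections to `L` are orthogonal. This splits the motion from `L` to `M` into
rotations in pairwise orthogonal planes, by the Jordan angles (`exists_planeRotations`). Rotating
uniformly gives a curve whose velocity has the constant singular values `Ψ_j`, so its length is
`ℓ(Ψ)`.

Lower bound. Along any curve, follow the squared cosines `κ_j(t)` of the angles between `γ(t)` and
`M`. By Ky Fan's principle their partial sums are maxima of sums of squared projections, hence
Lipschitz in the projector. At almost every time all `κ_j` are differentiable, and the maximum
property (an envelope argument) lets one freeze the principal vectors while differentiating
(`hasDerivAt_cosAngle_sq`). The derivatives of the angles are then, up to sign, diagonal entries of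
the velocity in two orthonormal systems. Such a diagonal is dominated by a doubly substochastic
image of the singular values, so Birkhoff's theorem and the symmetry of `ℓ` bound its norm by `F`
(`IsWeylInvariantNorm.le_singularValues`).

Pairing with a linear functional that norms `Ψ[L,M]` reduces the integration to a scalar inequality.
Since `arccos √κ` is not Lipschitz at `0` and `1`, the angle is replaced by `regAngle θ`, for which
the same bound holds for every `θ < 1`; then `θ → 1`. -/

/-! ### Symmetric norms and doubly stochastic matrices -/

namespace IsWeylInvariantNorm

variable {p : ℕ} {ℓ : (Fin p → ℝ) → ℝ}

theorem zero (hℓ : IsWeylInvariantNorm ℓ) : ℓ 0 = 0 := by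
  simpa using hℓ.smul 0 0

theorem neg (hℓ : IsWeylInvariantNorm ℓ) (x : Fin p → ℝ) : ℓ (-x) = ℓ x := by
  simpa using hℓ.smul (-1) x

theorem nonneg (hℓ : IsWeylInvariantNorm ℓ) (x : Fin p → ℝ) : 0 ≤ ℓ x := by
  have h := hℓ.add_le x (-x)
  rw [add_neg_cancel, hℓ.zero, hℓ.neg] at h
  linarith

/-- Every vector has a norming functional. -/
theorem exists_norming (hℓ : IsWeylInvariantNorm ℓ) (d : Fin p → ℝ) :
    ∃ y : (Fin p → ℝ) →ₗ[ℝ] ℝ, y d = ℓ d ∧ ∀ x, y x ≤ ℓ x := by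
  by_cases hd : d = 0
  · exact ⟨0, by simp [hd, hℓ.zero], fun x => by simpa using hℓ.nonneg x⟩
  obtain ⟨y, h1, h2⟩ := exists_extension_of_le_sublinear
    (LinearPMap.mkSpanSingleton d (ℓ d) hd) ℓ
    (fun c hc x => by rw [hℓ.smul, abs_of_pos hc]) hℓ.add_le (by
      rintro ⟨x, hx⟩
      obtain ⟨c, rfl⟩ := Submodule.mem_span_singleton.mp hx
      rw [LinearPMap.mkSpanSingleton'_apply, hℓ.smul, smul_eq_mul]
      exact mul_le_mul_of_nonneg_right (le_abs_self c) (hℓ.nonneg d))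
  refine ⟨y, ?_, h2⟩
  have := h1 ⟨d, Submodule.mem_span_singleton_self d⟩
  exact this.trans (LinearPMap.mkSpanSingleton_apply ℝ ℝ hd (ℓ d))

/-- A linear functional on `ℝ^p` dominated by `ℓ` satisfies `∑ |y_j| s_{σ j} ≤ ℓ s`. -/
theorem sum_abs_mul_perm_le (hℓ : IsWeylInvariantNorm ℓ) {y : Fin p → ℝ}
    (hy : ∀ x : Fin p → ℝ, ∑ j, y j * x j ≤ ℓ x) (s : Fin p → ℝ) (σ : Equiv.Perm (Fin p)) :
    ∑ j, |y j| * s (σ j) ≤ ℓ s := by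
  let ε : Fin p → ℤˣ := fun j => if 0 ≤ y j then 1 else -1
  have h := hy (fun j => ((ε j : ℤ) : ℝ) * (s ∘ σ) j)
  rw [hℓ.sign ε (s ∘ σ), hℓ.perm] at h
  refine le_trans (le_of_eq (Finset.sum_congr rfl fun j _ => ?_)) h
  by_cases hj : 0 ≤ y j
  · simp [ε, hj, abs_of_nonneg hj]
  · simp [ε, hj, abs_of_neg (not_le.mp hj)]

/-- A norming functional of `d` makes the claim linear in `D`, and Birkhoff's theorem reduces it to
permutation matrices, where the invariance of `ℓ` applies. -/
theorem le_of_abs_le_doublyStochastic (hℓ : IsWeylInvariantNorm ℓ)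
    {D : Matrix (Fin p) (Fin p) ℝ} (hD : D ∈ doublyStochastic ℝ (Fin p)) {d s : Fin p → ℝ}
    (hd : ∀ j, |d j| ≤ ∑ k, D j k * s k) : ℓ d ≤ ℓ s := by
  obtain ⟨y, hyd, hy⟩ := hℓ.exists_norming d
  have hsum : ∀ x, y x = ∑ j, y (Pi.single j 1) * x j := by
    intro x
    rw [LinearMap.pi_apply_eq_sum_univ y x]
    refine Finset.sum_congr rfl fun j _ => ?_
    rw [smul_eq_mul, mul_comm]
    congr 2
    ext i
    simp [Pi.single_apply, eq_comm]
  set z : Fin p → ℝ := fun j => y (Pi.single j 1) with hz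
  have hz' : ∀ x : Fin p → ℝ, ∑ j, z j * x j ≤ ℓ x := fun x => by
    rw [← hsum]; exact hy x
  obtain ⟨w, hw0, hw1, hwD⟩ := exists_eq_sum_perm_of_mem_doublyStochastic hD
  have hDs : ∀ j, ∑ k, D j k * s k = ∑ σ, w σ * s (σ j) := by
    intro j
    rw [← hwD]
    simp only [Matrix.sum_apply, Matrix.smul_apply, smul_eq_mul, Finset.sum_mul]
    rw [Finset.sum_comm]
    refine Finset.sum_congr rfl fun σ _ => ?_
    simp [Equiv.Perm.permMatrix, PEquiv.toMatrix_apply, Equiv.toPEquiv_apply]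
  calc ℓ d = ∑ j, z j * d j := by rw [← hyd, hsum]
    _ ≤ ∑ j, |z j| * ∑ k, D j k * s k := Finset.sum_le_sum fun j _ => by
        calc z j * d j ≤ |z j * d j| := le_abs_self _
          _ = |z j| * |d j| := abs_mul _ _
          _ ≤ _ := mul_le_mul_of_nonneg_left (hd j) (abs_nonneg _)
    _ = ∑ σ, w σ * ∑ j, |z j| * s (σ j) := by
        simp only [hDs, Finset.mul_sum]
        rw [Finset.sum_comm]
        exact Finset.sum_congr rfl fun σ _ => Finset.sum_congr rfl fun j _ => by ring
    _ ≤ ∑ σ, w σ * ℓ s := Finset.sum_le_sum fun σ _ =>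
        mul_le_mul_of_nonneg_left (hℓ.sum_abs_mul_perm_le hz' s σ) (hw0 σ)
    _ = ℓ s := by rw [← Finset.sum_mul, hw1, one_mul]

/-- A doubly substochastic matrix does not increase `ℓ`. -/
theorem le_of_abs_le_substochastic (hℓ : IsWeylInvariantNorm ℓ)
    {D : Matrix (Fin p) (Fin p) ℝ} (h0 : ∀ j k, 0 ≤ D j k) (hrow : ∀ j, ∑ k, D j k ≤ 1)
    (hcol : ∀ k, ∑ j, D j k ≤ 1) {d s : Fin p → ℝ} (hs : ∀ k, 0 ≤ s k)
    (hd : ∀ j, |d j| ≤ ∑ k, D j k * s k) : ℓ d ≤ ℓ s := by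
  set r : Fin p → ℝ := fun j => 1 - ∑ k, D j k with hr
  set c : Fin p → ℝ := fun k => 1 - ∑ j, D j k with hc
  have hr0 : ∀ j, 0 ≤ r j := fun j => sub_nonneg.mpr (hrow j)
  have hc0 : ∀ k, 0 ≤ c k := fun k => sub_nonneg.mpr (hcol k)
  have hrc : ∑ j, r j = ∑ k, c k := by
    simp only [hr, hc, Finset.sum_sub_distrib]
    rw [Finset.sum_comm]
  have hadd : ∀ j k, 0 ≤ r j * c k / ∑ i, r i := fun j k =>
    div_nonneg (mul_nonneg (hr0 j) (hc0 k)) (Finset.sum_nonneg fun i _ => hr0 i)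
  -- The row deficits `r` and column deficits `c` have the same total, so adding the rank-one matrix
  -- `r cᵀ / ∑ r` completes `D` to a doubly stochastic matrix. If the total is zero, the quotient is
  -- zero and all deficits already vanish.
  refine hℓ.le_of_abs_le_doublyStochastic (D := fun j k => D j k + r j * c k / ∑ i, r i)
    (mem_doublyStochastic_iff_sum.mpr ⟨fun j k => add_nonneg (h0 j k) (hadd j k), fun j => ?_,
      fun k => ?_⟩) fun j => (hd j).trans (Finset.sum_le_sum fun k _ =>
        mul_le_mul_of_nonneg_right (le_add_of_nonneg_right (hadd j k)) (hs k))
  · rw [Finset.sum_add_distrib, ← Finset.sum_div, ← Finset.mul_sum, ← hrc]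
    by_cases h : ∑ i, r i = 0
    · have := (Finset.sum_eq_zero_iff_of_nonneg fun i _ => hr0 i).mp h j (Finset.mem_univ j)
      rw [h, div_zero, add_zero]
      simp only [hr] at this
      linarith
    · rw [mul_div_assoc, div_self h]
      simp [hr]
  · rw [Finset.sum_add_distrib, ← Finset.sum_div, ← Finset.sum_mul]
    by_cases h : ∑ i, r i = 0
    · have := (Finset.sum_eq_zero_iff_of_nonneg fun i _ => hc0 i).mp (hrc ▸ h) k
        (Finset.mem_univ k)
      rw [h, div_zero, add_zero]
      simp only [hc] at this
      linarith
    · rw [mul_comm, mul_div_assoc, div_self h]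
      simp [hc]

end IsWeylInvariantNorm

/-! ### Bessel's inequality and Ky Fan's principle -/

section Bessel

variable {E : Type*} [NormedAddCommGroup E] [InnerProductSpace ℝ E]

/-- The Pythagorean identity for a pairwise orthogonal family. -/
theorem norm_sq_sum_smul_of_orthogonal {ι : Type*} [Fintype ι] {v : ι → E}
    (hv : ∀ i j, i ≠ j → ⟪v i, v j⟫ = 0) (c : ι → ℝ) :
    ‖∑ i, c i • v i‖ ^ 2 = ∑ i, c i ^ 2 * ‖v i‖ ^ 2 := by
  rw [← real_inner_self_eq_norm_sq, sum_inner]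
  refine Finset.sum_congr rfl fun i _ => ?_
  rw [inner_sum, Finset.sum_eq_single i]
  · rw [real_inner_smul_left, real_inner_smul_right, real_inner_self_eq_norm_sq]
    ring
  · intro j _ hj
    rw [real_inner_smul_left, real_inner_smul_right, hv i j hj.symm]
    ring
  · simp

/-- Bessel's inequality for orthogonal vectors of norm at most one. -/
theorem sum_sq_inner_le_of_orthogonal {ι : Type*} [Fintype ι] {v : ι → E}
    (hv : ∀ i j, i ≠ j → ⟪v i, v j⟫ = 0) (h1 : ∀ i, ‖v i‖ ≤ 1) (x : E) :
    ∑ i, ⟪v i, x⟫ ^ 2 ≤ ‖x‖ ^ 2 := by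
  have h := sq_nonneg ‖x - ∑ i, ⟪v i, x⟫ • v i‖
  rw [norm_sub_sq_real, norm_sq_sum_smul_of_orthogonal hv, inner_sum] at h
  have h2 : ∑ i, ⟪x, ⟪v i, x⟫ • v i⟫ = ∑ i, ⟪v i, x⟫ ^ 2 :=
    Finset.sum_congr rfl fun i _ => by
      rw [real_inner_smul_right, real_inner_comm]; ring
  have h3 : ∑ i, ⟪v i, x⟫ ^ 2 * ‖v i‖ ^ 2 ≤ ∑ i, ⟪v i, x⟫ ^ 2 :=
    Finset.sum_le_sum fun i _ => mul_le_of_le_one_right (sq_nonneg _)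
      (pow_le_one₀ (norm_nonneg _) (h1 i))
  rw [h2] at h
  linarith

/-- Ky Fan's maximum principle for an operator with a given singular value decomposition. -/
theorem LinearMap.sum_norm_sq_apply_le {F : Type*} [NormedAddCommGroup F] [InnerProductSpace ℝ F]
    (T : E →ₗ[ℝ] F) {n m : ℕ} {v : Fin n → E} (hv : Orthonormal ℝ v)
    {a : ℕ → ℝ} (ha : Antitone a) (ha0 : ∀ k, 0 ≤ a k)
    (hT : ∀ x, ‖T x‖ ^ 2 = ∑ k : Fin n, a k * ⟪v k, x⟫ ^ 2) {u : Fin m → E}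
    (hu : Orthonormal ℝ u) : ∑ i, ‖T (u i)‖ ^ 2 ≤ ∑ k ∈ Finset.range m, a k := by
  set w : Fin n → ℝ := fun k => ∑ i, ⟪u i, v k⟫ ^ 2 with hw
  have hw0 : ∀ k, 0 ≤ w k := fun k => Finset.sum_nonneg fun i _ => sq_nonneg _
  have hw1 : ∀ k, w k ≤ 1 := fun k => by
    refine (sum_sq_inner_le_of_orthogonal (fun i j hij => hu.2 hij) (fun i => (hu.1 i).le)
      (v k)).trans ?_
    rw [hv.1 k, one_pow]
  have hwm : ∑ k, w k ≤ m := by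
    rw [Finset.sum_comm]
    calc ∑ i, ∑ k, ⟪u i, v k⟫ ^ 2 ≤ ∑ i : Fin m, (1 : ℝ) := Finset.sum_le_sum fun i _ => by
          have := sum_sq_inner_le_of_orthogonal (fun i j hij => hv.2 hij) (fun i => (hv.1 i).le)
            (u i)
          rw [hu.1 i, one_pow] at this
          simpa only [real_inner_comm] using this
      _ = m := by simp
  have hsum : ∑ i, ‖T (u i)‖ ^ 2 = ∑ k : Fin n, a k * w k := by
    simp only [hT, hw, Finset.mul_sum]
    rw [Finset.sum_comm]
    simp only [real_inner_comm]
  -- The weights lie in `[0,1]` and have total at most `m`; comparing with the threshold `a m` shows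
  -- that placing them on the first `m` indices is optimal.
  have hle : ∀ k : Fin n, a k * w k ≤ a m * w k + if (k : ℕ) < m then a k - a m else 0 := by
    intro k
    split_ifs with hk
    · have := mul_nonneg (sub_nonneg.mpr (ha hk.le)) (sub_nonneg.mpr (hw1 k))
      linarith
    · have := mul_le_mul_of_nonneg_right (ha (not_lt.mp hk)) (hw0 k)
      linarith
  have htail : ∑ k : Fin n, (if (k : ℕ) < m then a k - a m else 0)
      ≤ ∑ k ∈ Finset.range m, (a k - a m) := by
    rw [Fin.sum_univ_eq_sum_range (fun k => if k < m then a k - a m else 0) n,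
      ← Finset.sum_filter]
    refine Finset.sum_le_sum_of_subset_of_nonneg (fun k hk => ?_) fun k hk _ => ?_
    · simpa using (Finset.mem_filter.mp hk).2
    · exact sub_nonneg.mpr (ha (Finset.mem_range.mp hk).le)
  calc ∑ i, ‖T (u i)‖ ^ 2 = ∑ k : Fin n, a k * w k := hsum
    _ ≤ a m * ∑ k, w k + ∑ k : Fin n, (if (k : ℕ) < m then a k - a m else 0) := by
        rw [Finset.mul_sum, ← Finset.sum_add_distrib]
        exact Finset.sum_le_sum fun k _ => hle k
    _ ≤ a m * m + ∑ k ∈ Finset.range m, (a k - a m) :=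
        add_le_add (mul_le_mul_of_nonneg_left hwm (ha0 m)) htail
    _ = ∑ k ∈ Finset.range m, a k := by
        rw [Finset.sum_sub_distrib, Finset.sum_const, Finset.card_range, nsmul_eq_mul]
        ring

end Bessel

/-! ### Singular values: variational description, uniqueness, continuity -/

namespace LinearMap

variable {E F F' : Type*} [NormedAddCommGroup E] [InnerProductSpace ℝ E] [FiniteDimensional ℝ E]
  [NormedAddCommGroup F] [InnerProductSpace ℝ F] [FiniteDimensional ℝ F]
  [NormedAddCommGroup F'] [InnerProductSpace ℝ F'] [FiniteDimensional ℝ F']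

/-- A basis of right singular vectors. -/
theorem exists_singularBasis (T : E →ₗ[ℝ] F) {n : ℕ} (hn : finrank ℝ E = n) :
    ∃ b : OrthonormalBasis (Fin n) ℝ E,
      (∀ i j, i ≠ j → ⟪T (b i), T (b j)⟫ = 0) ∧ ∀ i, ‖T (b i)‖ = T.singularValues i := by
  set b := T.isSymmetric_adjoint_comp_self.eigenvectorBasis hn with hb
  have h : ∀ i j, ⟪T (b i), T (b j)⟫ = T.singularValues j ^ 2 * ⟪b i, b j⟫ := by
    intro i j
    rw [← adjoint_inner_right, ← comp_apply, hb,
      T.isSymmetric_adjoint_comp_self.apply_eigenvectorBasis hn, real_inner_smul_right,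
      T.sq_singularValues_fin hn]
    rfl
  refine ⟨b, fun i j hij => ?_, fun i => ?_⟩
  · rw [h, b.inner_eq_zero hij, mul_zero]
  · rw [← sq_eq_sq₀ (norm_nonneg _) (T.singularValues_nonneg i), ← real_inner_self_eq_norm_sq, h,
      b.inner_eq_one, mul_one]

theorem norm_sq_apply_of_singularBasis (T : E →ₗ[ℝ] F) {n : ℕ}
    (b : OrthonormalBasis (Fin n) ℝ E) (hb : ∀ i j, i ≠ j → ⟪T (b i), T (b j)⟫ = 0)
    (hb' : ∀ i, ‖T (b i)‖ = T.singularValues i) (x : E) :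
    ‖T x‖ ^ 2 = ∑ k : Fin n, T.singularValues k ^ 2 * ⟪b k, x⟫ ^ 2 := by
  conv_lhs => rw [← b.sum_repr' x, map_sum]
  simp only [map_smul]
  rw [norm_sq_sum_smul_of_orthogonal hb]
  exact Finset.sum_congr rfl fun k _ => by rw [hb', mul_comm]

/-- The sum of the squares of the `m` largest singular values. -/
noncomputable def kyFan (T : E →ₗ[ℝ] F) (m : ℕ) : ℝ :=
  ∑ k ∈ Finset.range m, T.singularValues k ^ 2

theorem sq_singularValues_antitone (T : E →ₗ[ℝ] F) :
    Antitone fun k => T.singularValues k ^ 2 := fun _ _ hij =>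
  pow_le_pow_left₀ (T.singularValues_nonneg _) (T.singularValues_antitone hij) 2

theorem sum_norm_sq_le_kyFan (T : E →ₗ[ℝ] F) {m : ℕ} {u : Fin m → E} (hu : Orthonormal ℝ u) :
    ∑ i, ‖T (u i)‖ ^ 2 ≤ T.kyFan m := by
  obtain ⟨b, hb, hb'⟩ := T.exists_singularBasis rfl
  exact T.sum_norm_sq_apply_le b.orthonormal T.sq_singularValues_antitone
    (fun k => sq_nonneg _) (T.norm_sq_apply_of_singularBasis b hb hb') hu

theorem exists_sum_norm_sq_eq_kyFan (T : E →ₗ[ℝ] F) {m : ℕ} (hm : m ≤ finrank ℝ E) :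
    ∃ u : Fin m → E, Orthonormal ℝ u ∧ ∑ i, ‖T (u i)‖ ^ 2 = T.kyFan m := by
  obtain ⟨b, -, hb'⟩ := T.exists_singularBasis rfl
  refine ⟨fun i => b (Fin.castLE hm i),
    b.orthonormal.comp _ (Fin.castLE_injective hm), ?_⟩
  simp only [hb', Fin.val_castLE]
  exact Fin.sum_univ_eq_sum_range (fun k => T.singularValues k ^ 2) m

theorem sq_singularValues_eq_kyFan_sub (T : E →ₗ[ℝ] F) (k : ℕ) :
    T.singularValues k ^ 2 = T.kyFan (k + 1) - T.kyFan k := by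
  rw [kyFan, kyFan, Finset.sum_range_succ]
  ring

/-- Uniqueness of the singular values. -/
theorem singularValues_eq_of_norm_sq (T : E →ₗ[ℝ] F) {n : ℕ} {v : Fin n → E}
    (hv : Orthonormal ℝ v) {μ : ℕ → ℝ} (hμ : Antitone μ) (hμ0 : ∀ k, 0 ≤ μ k)
    (hT : ∀ x, ‖T x‖ ^ 2 = ∑ k : Fin n, μ k ^ 2 * ⟪v k, x⟫ ^ 2) {k : ℕ} (hk : k < n) :
    T.singularValues k = μ k := by
  have hn : n ≤ finrank ℝ E := by
    simpa using hv.linearIndependent.fintype_card_le_finrank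
  have hTv : ∀ i, ‖T (v i)‖ ^ 2 = μ i ^ 2 := by
    intro i
    rw [hT, Finset.sum_eq_single i]
    · rw [real_inner_self_eq_norm_sq, hv.1 i]; ring
    · intro j _ hj
      rw [hv.2 hj]; ring
    · simp
  -- The given decomposition bounds the maximum from above, and its first `m` vectors attain the
  -- bound. The system `v` need not span `E`.
  have key : ∀ m ≤ n, T.kyFan m = ∑ k ∈ Finset.range m, μ k ^ 2 := by
    intro m hm
    refine le_antisymm ?_ ?_
    · obtain ⟨u, hu, hu'⟩ := T.exists_sum_norm_sq_eq_kyFan (hm.trans hn)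
      rw [← hu']
      exact T.sum_norm_sq_apply_le hv
        (fun i j hij => pow_le_pow_left₀ (hμ0 _) (hμ hij) 2) (fun k => sq_nonneg _) hT hu
    · refine le_trans (le_of_eq ?_)
        (T.sum_norm_sq_le_kyFan (hv.comp _ (Fin.castLE_injective hm)))
      simp only [Function.comp_apply, hTv, Fin.val_castLE]
      exact (Fin.sum_univ_eq_sum_range (fun k => μ k ^ 2) m).symm
  rw [← sq_eq_sq₀ (T.singularValues_nonneg k) (hμ0 k), sq_singularValues_eq_kyFan_sub,
    key _ hk, key _ hk.le, Finset.sum_range_succ]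
  ring

/-- The singular values only depend on the function `x ↦ ‖T x‖`. -/
theorem singularValues_congr (T : E →ₗ[ℝ] F) (T' : E →ₗ[ℝ] F') (h : ∀ x, ‖T x‖ = ‖T' x‖)
    {k : ℕ} (hk : k < finrank ℝ E) : T.singularValues k = T'.singularValues k := by
  obtain ⟨b, hb, hb'⟩ := T'.exists_singularBasis rfl
  exact T.singularValues_eq_of_norm_sq b.orthonormal T'.singularValues_antitone
    T'.singularValues_nonneg
    (fun x => by rw [h, T'.norm_sq_apply_of_singularBasis b hb hb' x]) hk

/-- An orthonormal system optimal for `T` is a competitor for `S`; on each of its vectors the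
squared norms differ by at most `(‖T‖ + ‖S‖) * ‖T - S‖`. -/
theorem kyFan_le_add (T S : E →L[ℝ] F) {m : ℕ} (hm : m ≤ finrank ℝ E) :
    (T : E →ₗ[ℝ] F).kyFan m ≤ (S : E →ₗ[ℝ] F).kyFan m + m * (‖T‖ + ‖S‖) * ‖T - S‖ := by
  obtain ⟨u, hu, hu'⟩ := (T : E →ₗ[ℝ] F).exists_sum_norm_sq_eq_kyFan hm
  rw [← hu']
  refine le_trans ?_ (add_le_add_left ((S : E →ₗ[ℝ] F).sum_norm_sq_le_kyFan hu) _)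
  have : (m : ℝ) * (‖T‖ + ‖S‖) * ‖T - S‖ = ∑ i : Fin m, (‖T‖ + ‖S‖) * ‖T - S‖ := by
    simp [mul_assoc]
  rw [this, ← Finset.sum_add_distrib]
  refine Finset.sum_le_sum fun i _ => ?_
  simp only [ContinuousLinearMap.coe_coe]
  have hT : ‖T (u i)‖ ≤ ‖T‖ := by simpa [hu.1 i] using T.le_opNorm (u i)
  have hS : ‖S (u i)‖ ≤ ‖S‖ := by simpa [hu.1 i] using S.le_opNorm (u i)
  have hTS : ‖T (u i)‖ - ‖S (u i)‖ ≤ ‖T - S‖ := by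
    refine (norm_sub_norm_le _ _).trans ?_
    simpa [hu.1 i] using (T - S).le_opNorm (u i)
  nlinarith [norm_nonneg (T (u i)), norm_nonneg (S (u i)), norm_nonneg (T - S),
    mul_le_mul_of_nonneg_left hTS (add_nonneg (norm_nonneg (T (u i))) (norm_nonneg (S (u i)))),
    mul_le_mul_of_nonneg_right (add_le_add hT hS) (norm_nonneg (T - S))]

theorem abs_kyFan_sub_le (T S : E →L[ℝ] F) {m : ℕ} (hm : m ≤ finrank ℝ E) :
    |(T : E →ₗ[ℝ] F).kyFan m - (S : E →ₗ[ℝ] F).kyFan m| ≤ m * (‖T‖ + ‖S‖) * ‖T - S‖ := by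
  have h1 := kyFan_le_add T S hm
  have h2 := kyFan_le_add S T hm
  rw [add_comm ‖S‖, norm_sub_rev S T] at h2
  rw [abs_le]
  constructor <;> linarith

theorem continuous_kyFan {m : ℕ} (hm : m ≤ finrank ℝ E) :
    Continuous fun T : E →L[ℝ] F => (T : E →ₗ[ℝ] F).kyFan m := by
  rw [continuous_iff_continuousAt]
  intro S
  rw [ContinuousAt, tendsto_iff_dist_tendsto_zero]
  have hlim : Tendsto (fun T : E →L[ℝ] F => m * (‖T‖ + ‖S‖) * ‖T - S‖) (𝓝 S) (𝓝 0) := by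
    have : Continuous fun T : E →L[ℝ] F => m * (‖T‖ + ‖S‖) * ‖T - S‖ := by fun_prop
    simpa using this.tendsto S
  exact squeeze_zero (fun _ => dist_nonneg) (fun T => abs_kyFan_sub_le T S hm) hlim

theorem continuous_singularValues {k : ℕ} (hk : k < finrank ℝ E) :
    Continuous fun T : E →L[ℝ] F => (T : E →ₗ[ℝ] F).singularValues k := by
  have h : (fun T : E →L[ℝ] F => (T : E →ₗ[ℝ] F).singularValues k)
      = fun T : E →L[ℝ] F => √((T : E →ₗ[ℝ] F).kyFan (k + 1) - (T : E →ₗ[ℝ] F).kyFan k) := by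
    ext T
    rw [← sq_singularValues_eq_kyFan_sub, Real.sqrt_sq (singularValues_nonneg _ _)]
  rw [h]
  exact ((continuous_kyFan hk).sub (continuous_kyFan hk.le)).sqrt

end LinearMap

/-! ### Diagonals and singular values -/

/-- The diagonal of an operator in any two orthonormal systems is dominated by its singular
values. -/
theorem IsWeylInvariantNorm.le_singularValues {p : ℕ} {ℓ : (Fin p → ℝ) → ℝ}
    (hℓ : IsWeylInvariantNorm ℓ) {E F : Type*} [NormedAddCommGroup E] [InnerProductSpace ℝ E]
    [FiniteDimensional ℝ E] [NormedAddCommGroup F] [InnerProductSpace ℝ F] [FiniteDimensional ℝ F]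
    (hE : finrank ℝ E = p) (H : E →ₗ[ℝ] F) {f : Fin p → E} {g : Fin p → F}
    (hf : ∀ i j, i ≠ j → ⟪f i, f j⟫ = 0) (hf1 : ∀ i, ‖f i‖ ≤ 1)
    (hg : ∀ i j, i ≠ j → ⟪g i, g j⟫ = 0) (hg1 : ∀ i, ‖g i‖ ≤ 1)
    {d : Fin p → ℝ} (hd : ∀ j, |d j| ≤ |⟪H (f j), g j⟫|) :
    ℓ d ≤ ℓ fun j => H.singularValues (Fin.rev j) := by
  rw [show ℓ (fun j => H.singularValues (Fin.rev j)) = ℓ fun j : Fin p => H.singularValues j from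
    hℓ.perm Fin.revPerm fun j : Fin p => H.singularValues j]
  obtain ⟨v, hv, hv'⟩ := H.exists_singularBasis hE
  -- Left singular vectors; `w k` is zero when the singular value is, since `0⁻¹ = 0`. Hence only
  -- norm at most one, which suffices for Bessel.
  set w : Fin p → F := fun k => (H.singularValues k)⁻¹ • H (v k) with hw
  have hHv : ∀ k, H (v k) = H.singularValues k • w k := by
    intro k
    by_cases h : H.singularValues k = 0
    · rw [h, zero_smul, ← norm_eq_zero, hv', h]
    · rw [hw, smul_smul, mul_inv_cancel₀ h, one_smul]
  have hwo : ∀ i j, i ≠ j → ⟪w i, w j⟫ = 0 := by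
    intro i j hij
    simp only [hw, real_inner_smul_left, real_inner_smul_right, hv i j hij, mul_zero]
  have hw1 : ∀ k, ‖w k‖ ≤ 1 := by
    intro k
    rw [hw]
    simp only [norm_smul, norm_inv, hv', Real.norm_of_nonneg (H.singularValues_nonneg k)]
    exact inv_mul_le_one
  have hdiag : ∀ j, ⟪H (f j), g j⟫ = ∑ k : Fin p, ⟪v k, f j⟫ * ⟪w k, g j⟫ * H.singularValues k := by
    intro j
    conv_lhs => rw [← v.sum_repr' (f j), map_sum, sum_inner]
    refine Finset.sum_congr rfl fun k _ => ?_
    rw [map_smul, hHv, real_inner_smul_left, real_inner_smul_left]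
    ring
  have hvo : ∀ i j, i ≠ j → ⟪v i, v j⟫ = 0 := fun i j hij => v.inner_eq_zero hij
  have hv1 : ∀ k, ‖v k‖ ≤ 1 := fun k => (v.norm_eq_one k).le
  -- The matrix comes from `|ab| ≤ (a² + b²)/2` applied to the coefficients of `hdiag`; Bessel in
  -- each of the four systems bounds its row and column sums.
  refine hℓ.le_of_abs_le_substochastic
    (D := fun j k => (⟪v k, f j⟫ ^ 2 + ⟪w k, g j⟫ ^ 2) / 2) (fun j k => by positivity)
    (fun j => ?_) (fun k => ?_) (fun k => H.singularValues_nonneg k) fun j => ?_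
  · rw [← Finset.sum_div, Finset.sum_add_distrib]
    have h1 := sum_sq_inner_le_of_orthogonal hvo hv1 (f j)
    have h2 := sum_sq_inner_le_of_orthogonal hwo hw1 (g j)
    have h3 := pow_le_one₀ (n := 2) (norm_nonneg _) (hf1 j)
    have h4 := pow_le_one₀ (n := 2) (norm_nonneg _) (hg1 j)
    linarith
  · rw [← Finset.sum_div, Finset.sum_add_distrib]
    have h1 := sum_sq_inner_le_of_orthogonal hf hf1 (v k)
    have h2 := sum_sq_inner_le_of_orthogonal hg hg1 (w k)
    have h3 := pow_le_one₀ (n := 2) (norm_nonneg _) (hv1 k)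
    have h4 := pow_le_one₀ (n := 2) (norm_nonneg _) (hw1 k)
    simp only [real_inner_comm (v k)] at h1
    simp only [real_inner_comm (w k)] at h2
    linarith
  · refine (hd j).trans ?_
    rw [hdiag]
    refine (Finset.abs_sum_le_sum_abs _ _).trans (Finset.sum_le_sum fun k _ => ?_)
    rw [abs_mul, abs_of_nonneg (H.singularValues_nonneg k)]
    refine mul_le_mul_of_nonneg_right ?_ (H.singularValues_nonneg k)
    rw [abs_mul, ← sq_abs ⟪v k, f j⟫, ← sq_abs ⟪w k, g j⟫]
    linarith [two_mul_le_add_sq |⟪v k, f j⟫| |⟪w k, g j⟫|]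

/-- A version of `IsWeylInvariantNorm.le_singularValues` for systems that are not normalized. -/
theorem IsWeylInvariantNorm.le_singularValues_of_orthogonal {p : ℕ} {ℓ : (Fin p → ℝ) → ℝ}
    (hℓ : IsWeylInvariantNorm ℓ) {E F : Type*} [NormedAddCommGroup E] [InnerProductSpace ℝ E]
    [FiniteDimensional ℝ E] [NormedAddCommGroup F] [InnerProductSpace ℝ F] [FiniteDimensional ℝ F]
    (hE : finrank ℝ E = p) (H : E →ₗ[ℝ] F) {y : Fin p → E} {r : Fin p → F}
    (hy : ∀ i j, i ≠ j → ⟪y i, y j⟫ = 0) (hr : ∀ i j, i ≠ j → ⟪r i, r j⟫ = 0)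
    {d α : Fin p → ℝ} (hd : ∀ j, d j = α j * ⟪H (y j), r j⟫)
    (hα : ∀ j, |α j| * (‖y j‖ * ‖r j‖) ≤ 1) :
    ℓ d ≤ ℓ fun j => H.singularValues (Fin.rev j) := by
  refine hℓ.le_singularValues hE H
    (f := fun j => ‖y j‖⁻¹ • y j) (g := fun j => ‖r j‖⁻¹ • r j) (fun i j hij => ?_)
    (fun i => ?_) (fun i j hij => ?_) (fun i => ?_) fun j => ?_
  · rw [real_inner_smul_left, real_inner_smul_right, hy i j hij]; ring
  · rw [norm_smul, norm_inv, norm_norm]; exact inv_mul_le_one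
  · rw [real_inner_smul_left, real_inner_smul_right, hr i j hij]; ring
  · rw [norm_smul, norm_inv, norm_norm]; exact inv_mul_le_one
  · rw [hd j, map_smul, real_inner_smul_left, real_inner_smul_right]
    by_cases h1 : y j = 0
    · simp [h1]
    by_cases h2 : r j = 0
    · simp [h2]
    have h1' := norm_pos_iff.mpr h1
    have h2' := norm_pos_iff.mpr h2
    rw [← mul_assoc, abs_mul, abs_mul, abs_of_pos (a := ‖y j‖⁻¹ * ‖r j‖⁻¹) (by positivity)]
    refine mul_le_mul_of_nonneg_right ?_ (abs_nonneg _)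
    rw [← mul_inv, ← one_div, le_div_iff₀ (by positivity)]
    exact hα j

/-! ### Jordan angles and principal vectors -/

namespace Gr

variable {p q : ℕ}

/-- The isometric embedding of `ℝ^p` onto `M` given by the orthonormal basis of `M`. -/
noncomputable def frame (M : Gr p q) : EuclideanSpace ℝ (Fin p) →L[ℝ] AmbientSpace p q :=
  M.1.subtypeL ∘L (M.basis.repr.symm.toContinuousLinearEquiv :
    EuclideanSpace ℝ (Fin p) →L[ℝ] M.1)

theorem frame_mem (M : Gr p q) (x : EuclideanSpace ℝ (Fin p)) : M.frame x ∈ M.1 :=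
  (M.basis.repr.symm x).2

theorem inner_frame (M : Gr p q) (x y : EuclideanSpace ℝ (Fin p)) :
    ⟪M.frame x, M.frame y⟫ = ⟪x, y⟫ :=
  M.basis.repr.symm.inner_map_map x y

theorem norm_frame (M : Gr p q) (x : EuclideanSpace ℝ (Fin p)) : ‖M.frame x‖ = ‖x‖ :=
  M.basis.repr.symm.norm_map x

theorem frame_apply (M : Gr p q) (x : EuclideanSpace ℝ (Fin p)) :
    M.frame x = ∑ j, x j • (M.basis j : AmbientSpace p q) := by
  change ((M.basis.repr.symm x : M.1) : AmbientSpace p q) = _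
  rw [← M.basis.sum_repr_symm x]
  exact map_sum M.1.subtype _ _ |>.trans (Finset.sum_congr rfl fun j _ => map_smul M.1.subtype _ _)

theorem norm_frame_le (M : Gr p q) : ‖M.frame‖ ≤ 1 :=
  M.frame.opNorm_le_bound zero_le_one fun x => by rw [norm_frame, one_mul]

theorem norm_proj_le (L : Gr p q) : ‖L.proj‖ ≤ 1 := L.1.starProjection_norm_le

theorem inner_proj_left (L : Gr p q) (x y : AmbientSpace p q) :
    ⟪L.proj x, y⟫ = ⟪x, L.proj y⟫ := L.1.starProjection_isSymmetric x y

theorem proj_mem (L : Gr p q) (x : AmbientSpace p q) : L.proj x ∈ L.1 :=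
  L.1.starProjection_apply_mem x

theorem proj_of_mem (L : Gr p q) {x : AmbientSpace p q} (hx : x ∈ L.1) : L.proj x = x :=
  Submodule.starProjection_eq_self_iff.mpr hx

theorem sub_proj_mem (L : Gr p q) (x : AmbientSpace p q) : x - L.proj x ∈ L.1ᗮ :=
  L.1.sub_starProjection_mem_orthogonal x

theorem proj_proj (L : Gr p q) (x : AmbientSpace p q) : L.proj (L.proj x) = L.proj x :=
  L.proj_of_mem (L.proj_mem x)

theorem norm_gramMatrix_apply (L M : Gr p q) (x : EuclideanSpace ℝ (Fin p)) :
    ‖Matrix.toEuclideanLin (gramMatrix L M) x‖ = ‖(L.proj ∘L M.frame) x‖ := by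
  have h : Matrix.toEuclideanLin (gramMatrix L M) x
      = L.basis.repr (L.1.orthogonalProjectionOnto (M.frame x)) := by
    ext i
    rw [L.basis.repr_apply_apply]
    refine Eq.trans ?_ (Submodule.inner_orthogonalProjectionOnto_eq_of_mem_left
      (L.basis i) (M.frame x)).symm
    simp [frame_apply, inner_sum, real_inner_smul_right, Matrix.toEuclideanLin,
      Matrix.mulVec, dotProduct, gramMatrix, mul_comm]
  rw [h, LinearIsometryEquiv.norm_map]
  rfl

/-- The Gram matrix is the projection to `L` restricted to `M`, in coordinates. This form depends on
`L` only through its projector, and its domain stays fixed as `L` moves. -/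
theorem cosAngle_eq (L M : Gr p q) (j : Fin p) :
    cosAngle L M j =
      ((L.proj ∘L M.frame : EuclideanSpace ℝ (Fin p) →L[ℝ] AmbientSpace p q) :
        EuclideanSpace ℝ (Fin p) →ₗ[ℝ] AmbientSpace p q).singularValues j :=
  LinearMap.singularValues_congr _ _ (fun x => norm_gramMatrix_apply L M x) (by simp)

theorem cosAngle_nonneg (L M : Gr p q) (j : Fin p) : 0 ≤ cosAngle L M j :=
  LinearMap.singularValues_nonneg _ _

/-- Principal vectors: an orthonormal system in `M` whose projections to `L` are orthogonal and
have the lengths `cosAngle L M j`. -/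
theorem exists_principal (L M : Gr p q) :
    ∃ u : OrthonormalBasis (Fin p) ℝ (EuclideanSpace ℝ (Fin p)),
      (∀ i j, i ≠ j → ⟪L.proj (M.frame (u i)), L.proj (M.frame (u j))⟫ = 0) ∧
      ∀ i, ‖L.proj (M.frame (u i))‖ = cosAngle L M i := by
  obtain ⟨u, h1, h2⟩ := LinearMap.exists_singularBasis
    ((L.proj ∘L M.frame : EuclideanSpace ℝ (Fin p) →L[ℝ] AmbientSpace p q) :
        EuclideanSpace ℝ (Fin p) →ₗ[ℝ] AmbientSpace p q) (n := p) (by simp)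
  exact ⟨u, h1, fun i => by rw [cosAngle_eq]; exact h2 i⟩

theorem norm_proj_apply_le (L : Gr p q) (x : AmbientSpace p q) : ‖L.proj x‖ ≤ ‖x‖ := by
  simpa using L.proj.le_of_opNorm_le L.norm_proj_le x

theorem cosAngle_le_one (L M : Gr p q) (j : Fin p) : cosAngle L M j ≤ 1 := by
  obtain ⟨u, -, h⟩ := exists_principal L M
  rw [← h]
  refine (L.norm_proj_apply_le _).trans ?_
  rw [norm_frame, u.norm_eq_one]

theorem cosAngle_self (L : Gr p q) (j : Fin p) : cosAngle L L j = 1 := by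
  obtain ⟨u, -, h⟩ := exists_principal L L
  rw [← h, L.proj_of_mem (L.frame_mem _), norm_frame, u.norm_eq_one]

theorem cosAngle_antitone (L M : Gr p q) : Antitone (cosAngle L M) := fun _ _ hij =>
  LinearMap.singularValues_antitone _ hij

theorem angle_monotone (L M : Gr p q) : Monotone (angle L M) := fun _ _ hij =>
  Real.arccos_le_arccos (cosAngle_antitone L M hij)

theorem angle_nonneg (L M : Gr p q) (j : Fin p) : 0 ≤ angle L M j := Real.arccos_nonneg _

theorem cos_angle (L M : Gr p q) (j : Fin p) : Real.cos (angle L M j) = cosAngle L M j :=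
  Real.cos_arccos (by linarith [cosAngle_nonneg L M j]) (cosAngle_le_one L M j)

theorem sin_angle_sq (L M : Gr p q) (j : Fin p) :
    Real.sin (angle L M j) ^ 2 = 1 - cosAngle L M j ^ 2 := by
  rw [Real.sin_sq, cos_angle]

theorem angle_eq_zero_of_sin (L M : Gr p q) (j : Fin p) (h : Real.sin (angle L M j) = 0) :
    angle L M j = 0 := by
  by_contra hne
  refine (Real.sin_pos_of_pos_of_lt_pi ((angle_nonneg L M j).lt_of_ne' hne) ?_).ne' h
  have : angle L M j ≤ Real.pi / 2 := Real.arccos_le_pi_div_two.mpr (cosAngle_nonneg L M j)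
  linarith [Real.pi_pos]

end Gr

/-! ### Curves generated by rotations in orthogonal planes -/

/-- Data for a product of rotations in pairwise orthogonal planes spanned by `e j`, `g j`, with
angular velocities `ψ j`; the vector `g j` vanishes where there is no rotation. -/
structure PlaneRotations {p : ℕ} {E : Type*} [NormedAddCommGroup E] [InnerProductSpace ℝ E]
    (e g : Fin p → E) (ψ : Fin p → ℝ) : Prop where
  orthonormal : Orthonormal ℝ e
  inner_e_g : ∀ i j, ⟪e i, g j⟫ = 0
  inner_g_g : ∀ i j, i ≠ j → ⟪g i, g j⟫ = 0
  norm_g : ∀ i, ψ i ≠ 0 → ⟪g i, g i⟫ = 1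

namespace PlaneRotations

variable {p q : ℕ} {E : Type*} [NormedAddCommGroup E] [InnerProductSpace ℝ E]

/-- The rotated vectors. -/
noncomputable def vec (e g : Fin p → E) (ψ : Fin p → ℝ) (t : ℝ) (j : Fin p) : E :=
  Real.cos (t * ψ j) • e j + Real.sin (t * ψ j) • g j

/-- The velocities of the rotated vectors. -/
noncomputable def vel (e g : Fin p → E) (ψ : Fin p → ℝ) (t : ℝ) (j : Fin p) : E :=
  (-(Real.sin (t * ψ j) * ψ j)) • e j + (Real.cos (t * ψ j) * ψ j) • g j

theorem hasDerivAt_vec (e g : Fin p → E) (ψ : Fin p → ℝ) (t : ℝ) (j : Fin p) :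
    HasDerivAt (fun s => vec e g ψ s j) (vel e g ψ t j) t := by
  have h : HasDerivAt (fun s : ℝ => s * ψ j) (ψ j) t := by
    simpa using (hasDerivAt_id t).mul_const (ψ j)
  have hc := (h.cos.smul_const (e j)).add (h.sin.smul_const (g j))
  simpa only [vec, vel, neg_mul] using! hc

variable {e g : Fin p → E} {ψ : Fin p → ℝ}

theorem inner_e_e (h : PlaneRotations e g ψ) (i j : Fin p) (hij : i ≠ j) : ⟪e i, e j⟫ = 0 :=
  h.orthonormal.2 hij

theorem inner_e_self (h : PlaneRotations e g ψ) (i : Fin p) : ⟪e i, e i⟫ = 1 := by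
  rw [real_inner_self_eq_norm_sq, h.orthonormal.1, one_pow]

theorem inner_g_e (h : PlaneRotations e g ψ) (i j : Fin p) : ⟪g i, e j⟫ = 0 := by
  rw [real_inner_comm, h.inner_e_g]

theorem orthonormal_vec (h : PlaneRotations e g ψ) (t : ℝ) : Orthonormal ℝ (vec e g ψ t) := by
  constructor
  · intro i
    rw [← sq_eq_sq₀ (norm_nonneg _) zero_le_one, ← real_inner_self_eq_norm_sq]
    simp only [vec, inner_add_left, inner_add_right, real_inner_smul_left, real_inner_smul_right,
      h.inner_e_g, h.inner_g_e, h.inner_e_self]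
    by_cases hi : ψ i = 0
    · simp [hi]
    · rw [h.norm_g i hi]
      linear_combination Real.sin_sq_add_cos_sq (t * ψ i)
  · intro i j hij
    simp only [vec, inner_add_left, inner_add_right, real_inner_smul_left, real_inner_smul_right,
      h.inner_e_g, h.inner_g_e, h.inner_e_e i j hij, h.inner_g_g i j hij]
    ring

theorem inner_vel_vec (h : PlaneRotations e g ψ) (t : ℝ) (i j : Fin p) :
    ⟪vel e g ψ t i, vec e g ψ t j⟫ = 0 := by
  simp only [vec, vel, inner_add_left, inner_add_right, real_inner_smul_left,
    real_inner_smul_right, h.inner_e_g, h.inner_g_e]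
  by_cases hij : i = j
  · subst hij
    rw [h.inner_e_self]
    by_cases hi : ψ i = 0
    · simp [hi]
    · rw [h.norm_g i hi]
      ring
  · rw [h.inner_e_e i j hij, h.inner_g_g i j hij]
    ring

theorem inner_vel_vel (h : PlaneRotations e g ψ) (t : ℝ) (i j : Fin p) (hij : i ≠ j) :
    ⟪vel e g ψ t i, vel e g ψ t j⟫ = 0 := by
  simp only [vel, inner_add_left, inner_add_right, real_inner_smul_left,
    real_inner_smul_right, h.inner_e_g, h.inner_g_e, h.inner_e_e i j hij, h.inner_g_g i j hij]
  ring

theorem norm_vel_sq (h : PlaneRotations e g ψ) (t : ℝ) (i : Fin p) :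
    ‖vel e g ψ t i‖ ^ 2 = ψ i ^ 2 := by
  rw [← real_inner_self_eq_norm_sq]
  simp only [vel, inner_add_left, inner_add_right, real_inner_smul_left,
    real_inner_smul_right, h.inner_e_g, h.inner_g_e, h.inner_e_self]
  by_cases hi : ψ i = 0
  · simp [hi]
  · rw [h.norm_g i hi]
    linear_combination ψ i ^ 2 * Real.sin_sq_add_cos_sq (t * ψ i)

/-- The curve of the subspaces spanned by the rotated vectors. -/
noncomputable def curve {e g : Fin p → AmbientSpace p q} {ψ : Fin p → ℝ}
    (h : PlaneRotations e g ψ) (t : ℝ) : Gr p q :=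
  ⟨Submodule.span ℝ (range (vec e g ψ t)), by
    rw [finrank_span_eq_card (h.orthonormal_vec t).linearIndependent, Fintype.card_fin]⟩

variable {e g : Fin p → AmbientSpace p q} {ψ : Fin p → ℝ}

theorem vec_mem_curve (h : PlaneRotations e g ψ) (t : ℝ) (j : Fin p) :
    vec e g ψ t j ∈ (h.curve t).1 :=
  Submodule.subset_span (mem_range_self j)

theorem curve_eq (h : PlaneRotations e g ψ) (t : ℝ) (L : Gr p q)
    (hL : ∀ j, vec e g ψ t j ∈ L.1) : h.curve t = L :=
  Subtype.ext (Submodule.eq_of_le_of_finrank_eq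
    (Submodule.span_le.mpr (range_subset_iff.mpr hL)) ((h.curve t).2.trans L.2.symm))

theorem mem_curve_orthogonal (h : PlaneRotations e g ψ) (t : ℝ) {x : AmbientSpace p q}
    (hx : ∀ j, ⟪vec e g ψ t j, x⟫ = 0) : x ∈ (h.curve t).1ᗮ := by
  rw [Submodule.mem_orthogonal]
  intro u hu
  induction hu using Submodule.span_induction with
  | mem y hy => obtain ⟨j, rfl⟩ := hy; exact hx j
  | zero => exact inner_zero_left x
  | add a b _ _ ha hb => rw [inner_add_left, ha, hb, add_zero]
  | smul c a _ ha => rw [real_inner_smul_left, ha, mul_zero]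

theorem inner_vel_of_mem (h : PlaneRotations e g ψ) (t : ℝ) (j : Fin p) {y : AmbientSpace p q}
    (hy : y ∈ (h.curve t).1) : ⟪vel e g ψ t j, y⟫ = 0 := by
  rw [real_inner_comm]
  exact h.mem_curve_orthogonal t
    (fun i => by rw [real_inner_comm]; exact h.inner_vel_vec t j i) y hy

theorem proj_curve (h : PlaneRotations e g ψ) (t : ℝ) (x : AmbientSpace p q) :
    (h.curve t).proj x = ∑ j, ⟪vec e g ψ t j, x⟫ • vec e g ψ t j := by
  refine Submodule.eq_starProjection_of_mem_orthogonal
    (Submodule.sum_mem _ fun j _ => Submodule.smul_mem _ _ (h.vec_mem_curve t j))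
    (h.mem_curve_orthogonal t fun i => ?_)
  rw [inner_sub_right, (h.orthonormal_vec t).inner_right_fintype, sub_self]

theorem contDiff_proj_curve (h : PlaneRotations e g ψ) :
    ContDiff ℝ 1 fun t => (h.curve t).proj := by
  have : (fun t => (h.curve t).proj) = fun t => ∑ j,
      ((Real.cos (t * ψ j) ^ 2) • InnerProductSpace.rankOne ℝ (e j) (e j)
      + (Real.cos (t * ψ j) * Real.sin (t * ψ j)) • (InnerProductSpace.rankOne ℝ (e j) (g j)
        + InnerProductSpace.rankOne ℝ (g j) (e j))
      + (Real.sin (t * ψ j) ^ 2) • InnerProductSpace.rankOne ℝ (g j) (g j)) := by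
    ext1 t
    ext1 x
    rw [h.proj_curve, sum_apply]
    refine Finset.sum_congr rfl fun j _ => ?_
    simp only [vec, add_apply, smul_apply,
      InnerProductSpace.rankOne_apply, inner_add_left, real_inner_smul_left]
    module
  rw [this]
  fun_prop

theorem deriv_proj_curve (h : PlaneRotations e g ψ) (t : ℝ) (x : AmbientSpace p q) :
    deriv (fun s => (h.curve s).proj) t x =
      ∑ j, (⟪vec e g ψ t j, x⟫ • vel e g ψ t j + ⟪vel e g ψ t j, x⟫ • vec e g ψ t j) := by
  have h1 := ((h.contDiff_proj_curve.differentiable one_ne_zero) t).hasDerivAt.clm_apply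
    (hasDerivAt_const t x)
  rw [map_zero, add_zero] at h1
  simp only [h.proj_curve] at h1
  refine h1.unique (HasDerivAt.fun_sum fun j _ => ?_)
  have h2 := ((hasDerivAt_vec e g ψ t j).inner ℝ (hasDerivAt_const t x)).smul
    (hasDerivAt_vec e g ψ t j)
  simpa using! h2

/-- On the subspace itself the terms `⟪vel, y⟫ • vec` of the derivative vanish, so the velocity
sends each rotated vector to its own derivative. -/
theorem velocity_curve (h : PlaneRotations e g ψ) (t : ℝ) (y : (h.curve t).1) :
    (Gr.velocity h.curve t y : AmbientSpace p q)
      = ∑ j, ⟪vec e g ψ t j, (y : AmbientSpace p q)⟫ • vel e g ψ t j := by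
  change (((h.curve t).1ᗮ.orthogonalProjectionOnto
    (deriv (fun s => (h.curve s).proj) t (y : AmbientSpace p q)) : (h.curve t).1ᗮ) :
      AmbientSpace p q) = _
  rw [h.deriv_proj_curve]
  have h1 : ∑ j, (⟪vec e g ψ t j, (y : AmbientSpace p q)⟫ • vel e g ψ t j
      + ⟪vel e g ψ t j, (y : AmbientSpace p q)⟫ • vec e g ψ t j)
      = ∑ j, ⟪vec e g ψ t j, (y : AmbientSpace p q)⟫ • vel e g ψ t j :=
    Finset.sum_congr rfl fun j _ => by
      rw [h.inner_vel_of_mem t j y.2, zero_smul, add_zero]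
  rw [h1, Submodule.coe_orthogonalProjectionOnto_apply, Submodule.starProjection_eq_self_iff]
  exact Submodule.sum_mem _ fun j _ => Submodule.smul_mem _ _
    (h.mem_curve_orthogonal t fun i => by rw [real_inner_comm]; exact h.inner_vel_vec t j i)

/-- The velocity maps an orthonormal basis to orthogonal vectors of lengths `ψ j`: this is a
singular value decomposition, and uniqueness applies. -/
theorem rho_velocity_curve (h : PlaneRotations e g ψ) (hψ : Monotone ψ) (hψ0 : ∀ j, 0 ≤ ψ j)
    (t : ℝ) : Gr.rho (h.curve t) (Gr.velocity h.curve t) = ψ := by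
  -- The increasing `ψ` is reversed and extended by zero, to match the decreasing enumeration of
  -- singular values by `ℕ`.
  set μ : ℕ → ℝ := fun k => if hk : k < p then ψ (Fin.rev ⟨k, hk⟩) else 0 with hμ
  have hμ0 : ∀ k, 0 ≤ μ k := fun k => by
    simp only [hμ]; split_ifs; exacts [hψ0 _, le_rfl]
  have hμa : Antitone μ := by
    intro i j hij
    by_cases hj : j < p
    · simp only [hμ, hj, hij.trans_lt hj, dif_pos]
      exact hψ (Fin.rev_le_rev.mpr (by simpa using hij))
    · simp only [hμ, hj, dif_neg, not_false_eq_true]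
      exact hμ0 i
  let v : Fin p → (h.curve t).1 := fun k => ⟨vec e g ψ t k.rev, h.vec_mem_curve t k.rev⟩
  have hv : Orthonormal ℝ v :=
    (LinearIsometry.orthonormal_comp_iff (h.curve t).1.subtypeₗᵢ).mp
      ((h.orthonormal_vec t).comp _ Fin.rev_injective)
  ext j
  have hsv := LinearMap.singularValues_eq_of_norm_sq
    (Gr.velocity h.curve t : (h.curve t).1 →ₗ[ℝ] (h.curve t).1ᗮ) hv hμa hμ0 (fun y => ?_)
    (Fin.rev j).2
  · rw [Gr.rho, hsv]
    simp only [hμ, dif_pos (Fin.rev j).2, Fin.eta, Fin.rev_rev]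
  · change ‖(Gr.velocity h.curve t y : AmbientSpace p q)‖ ^ 2 = _
    rw [h.velocity_curve t y, norm_sq_sum_smul_of_orthogonal (h.inner_vel_vel t)]
    refine Fintype.sum_equiv Fin.revPerm _ _ fun k => ?_
    have hk : μ (Fin.revPerm k) = ψ k := by
      simp only [hμ, Fin.eta, Fin.revPerm_apply, Fin.rev_rev]
      exact dif_pos k.rev.2
    rw [hk, h.norm_vel_sq, mul_comm]
    change _ = ψ k ^ 2 * ⟪vec e g ψ t k.rev.rev, (y : AmbientSpace p q)⟫ ^ 2
    rw [Fin.rev_rev]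

end PlaneRotations

/-! ### The geodesic joining two subspaces -/

namespace Gr

variable {p q : ℕ}

/-- A principal vector of `M` is the sum of its projection to `L`, of length `cos Ψ_j`, and a
residue in `L^⊥`, of length `sin Ψ_j`. Normalizing both parts yields `e j` and `g j`, and time `1`
returns the principal vector. -/
theorem exists_planeRotations (L M : Gr p q) :
    ∃ (e g : Fin p → AmbientSpace p q), PlaneRotations e g (angle L M) ∧ (∀ j, e j ∈ L.1) ∧
      ∀ j, PlaneRotations.vec e g (angle L M) 1 j ∈ M.1 := by
  obtain ⟨u, hu0, hu1⟩ := exists_principal L M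
  set x : Fin p → AmbientSpace p q := fun j => M.frame (u j) with hx
  let f : Fin p → L.1 := fun j => ⟨L.proj (x j), L.proj_mem _⟩
  have hf : Pairwise fun i j => ⟪f i, f j⟫ = 0 := fun i j hij => hu0 i j hij
  have hcard : finrank ℝ L.1 = Fintype.card (Fin p) := by rw [L.2, Fintype.card_fin]
  -- On an orthogonal family this only normalizes the nonzero vectors; it also supplies basis
  -- vectors where the projection vanishes, that is, at angle `π/2`.
  let b := InnerProductSpace.gramSchmidtOrthonormalBasis hcard f
  let e : Fin p → AmbientSpace p q := fun j => (b j : AmbientSpace p q)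
  have he : ∀ j, e j ∈ L.1 := fun j => (b j).2
  have hor : Orthonormal ℝ e := b.orthonormal.comp_linearIsometry L.1.subtypeₗᵢ
  have hproj : ∀ j, L.proj (x j) = cosAngle L M j • e j := by
    intro j
    by_cases hj : f j = 0
    · have h0 : L.proj (x j) = 0 := congrArg Subtype.val hj
      rw [← hu1 j]
      change _ = ‖L.proj (x j)‖ • e j
      rw [h0, norm_zero, zero_smul]
    · have hb : b j = (‖f j‖⁻¹ : ℝ) • f j :=
        InnerProductSpace.gramSchmidtOrthonormalBasis_apply_of_orthogonal hcard hf hj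
      have hn : ‖f j‖ = cosAngle L M j := hu1 j
      change _ = cosAngle L M j • ((b j : L.1) : AmbientSpace p q)
      rw [hb, ← hn, Submodule.coe_smul, smul_smul, mul_inv_cancel₀ (norm_ne_zero_iff.mpr hj),
        one_smul]
  set r : Fin p → AmbientSpace p q := fun j => x j - L.proj (x j) with hr
  have hrm : ∀ j, r j ∈ L.1ᗮ := fun j => L.sub_proj_mem _
  have hxx : ∀ i j, ⟪x i, x j⟫ = ⟪u i, u j⟫ := fun i j => M.inner_frame _ _
  have hrr : ∀ i j, ⟪r i, r j⟫ = ⟪u i, u j⟫ - ⟪L.proj (x i), L.proj (x j)⟫ := by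
    intro i j
    have h1 : ⟪r i, L.proj (x j)⟫ = 0 := by
      rw [real_inner_comm]; exact hrm i _ (L.proj_mem _)
    have h2 : ⟪L.proj (x i), r j⟫ = 0 := hrm j _ (L.proj_mem _)
    have h3 : ⟪x i, x j⟫ = ⟪L.proj (x i) + r i, L.proj (x j) + r j⟫ := by simp [hr]
    rw [inner_add_left, inner_add_right, inner_add_right, h1, h2, hxx] at h3
    linarith
  have hrself : ∀ j, ⟪r j, r j⟫ = Real.sin (angle L M j) ^ 2 := by
    intro j
    rw [hrr, u.inner_eq_one, real_inner_self_eq_norm_sq, hu1, sin_angle_sq]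
  refine ⟨e, fun j => (Real.sin (angle L M j))⁻¹ • r j, ⟨hor, fun i j => ?_, fun i j hij => ?_,
    fun i hi => ?_⟩, he, fun j => ?_⟩
  · rw [real_inner_smul_right, hrm j _ (he i), mul_zero]
  · rw [real_inner_smul_left, real_inner_smul_right, hrr, u.inner_eq_zero hij, hu0 i j hij]
    ring
  · have : Real.sin (angle L M i) ≠ 0 := fun h => hi (angle_eq_zero_of_sin L M i h)
    rw [real_inner_smul_left, real_inner_smul_right, hrself]
    field_simp
  · have : PlaneRotations.vec e (fun j => (Real.sin (angle L M j))⁻¹ • r j) (angle L M) 1 j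
        = x j := by
      rw [PlaneRotations.vec, one_mul, cos_angle, ← hproj, smul_smul]
      by_cases h : Real.sin (angle L M j) = 0
      · have h0 : r j = 0 := by
          rw [← inner_self_eq_zero (𝕜 := ℝ), hrself, h]; norm_num
        rw [h, zero_mul, zero_smul, add_zero]
        exact (sub_eq_zero.mp h0).symm
      · rw [mul_inv_cancel₀ h, one_smul]
        simp [hr]
    rw [this]
    exact M.frame_mem _

/-- The geodesic from `L` to `M`. -/
theorem exists_geodesic (ℓ : (Fin p → ℝ) → ℝ) (L M : Gr p q) :
    ℓ (fun j => angle L M j) ∈ curveLengths ℓ L M := by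
  obtain ⟨e, g, h, he, hM⟩ := exists_planeRotations L M
  refine ⟨h.curve, ⟨h.curve_eq 0 L fun j => ?_, h.curve_eq 1 M hM, 1, ![0, 1], ?_, rfl, rfl,
    fun i => h.contDiff_proj_curve.contDiffOn⟩, ?_⟩
  · simpa [PlaneRotations.vec] using he j
  · intro i j hij
    fin_cases i <;> fin_cases j <;> simp_all
  · simp [finslerLength, finsler,
      h.rho_velocity_curve (angle_monotone L M) (angle_nonneg L M)]

end Gr

/-! ### Continuity of the norm; tangent vectors and the metric -/

theorem IsWeylInvariantNorm.continuous {p : ℕ} {ℓ : (Fin p → ℝ) → ℝ}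
    (hℓ : IsWeylInvariantNorm ℓ) : Continuous ℓ := by
  have hsum : ∀ (s : Finset (Fin p)) (z : Fin p → Fin p → ℝ), ℓ (∑ i ∈ s, z i) ≤ ∑ i ∈ s, ℓ (z i) :=
    fun s z => Finset.le_sum_of_subadditive ℓ hℓ.zero.le hℓ.add_le s z
  have hbound : ∀ x, ℓ x ≤ ∑ i, |x i| * ℓ (Pi.single i 1) := by
    intro x
    have hx : x = ∑ i, x i • Pi.single i (1 : ℝ) := by
      ext j
      simp [Finset.sum_apply, Pi.single_apply]
    conv_lhs => rw [hx]
    refine (hsum _ _).trans (le_of_eq (Finset.sum_congr rfl fun i _ => hℓ.smul _ _))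
  have hsub : ∀ x y, ℓ x - ℓ y ≤ ℓ (x - y) := fun x y => by
    have := hℓ.add_le (x - y) y
    rw [sub_add_cancel] at this
    linarith
  rw [continuous_iff_continuousAt]
  intro y
  rw [ContinuousAt, tendsto_iff_dist_tendsto_zero]
  have hlim : Tendsto (fun x : Fin p → ℝ => ∑ i, |x i - y i| * ℓ (Pi.single i 1)) (𝓝 y) (𝓝 0) := by
    have : Continuous fun x : Fin p → ℝ => ∑ i, |x i - y i| * ℓ (Pi.single i 1) := by fun_prop
    simpa using this.tendsto y
  refine squeeze_zero (fun _ => dist_nonneg) (fun x => ?_) hlim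
  rw [Real.dist_eq, abs_le]
  have h1 := hsub x y
  have h2 := hsub y x
  have h3 := hbound (x - y)
  rw [← neg_sub x y, hℓ.neg] at h2
  simp only [Pi.sub_apply] at h3
  constructor <;> linarith

namespace Gr

variable {p q : ℕ}

/-- The extension by zero of a tangent vector to an operator of the ambient space. -/
noncomputable def ambient (K : Gr p q) (D : AmbientSpace p q →L[ℝ] AmbientSpace p q) :
    AmbientSpace p q →L[ℝ] AmbientSpace p q :=
  (ContinuousLinearMap.id ℝ _ - K.proj) ∘L D ∘L K.proj

/-- The spaces `Tangent (γ t)` vary with `t`. Extending by zero to the ambient space keeps the first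
`p` singular values, and their continuity along a curve can then be stated. -/
theorem rho_eq_ambient (K : Gr p q) (D : AmbientSpace p q →L[ℝ] AmbientSpace p q) (H : Tangent K)
    (hH : ∀ y : K.1, (H y : AmbientSpace p q) = D y - K.proj (D y)) :
    rho K H = fun j => (ambient K D : AmbientSpace p q →ₗ[ℝ] AmbientSpace p q).singularValues
      (Fin.rev j) := by
  obtain ⟨b, hb, hb'⟩ := LinearMap.exists_singularBasis (H : K.1 →ₗ[ℝ] K.1ᗮ) K.2
  ext j
  refine (LinearMap.singularValues_eq_of_norm_sq _
    (b.orthonormal.comp_linearIsometry K.1.subtypeₗᵢ)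
    (LinearMap.singularValues_antitone (H : K.1 →ₗ[ℝ] K.1ᗮ))
    (LinearMap.singularValues_nonneg _) (fun x => ?_) (Fin.rev j).2).symm
  have h1 := LinearMap.norm_sq_apply_of_singularBasis (H : K.1 →ₗ[ℝ] K.1ᗮ) b hb hb'
    ⟨K.proj x, K.proj_mem x⟩
  have h2 : (ambient K D : AmbientSpace p q →ₗ[ℝ] AmbientSpace p q) x
      = (H ⟨K.proj x, K.proj_mem x⟩ : AmbientSpace p q) := by
    rw [hH]
    simp [ambient]
  rw [h2]
  refine h1.trans (Finset.sum_congr rfl fun k _ => ?_)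
  congr 2
  change ⟪(b k : AmbientSpace p q), K.proj x⟫ = ⟪(b k : AmbientSpace p q), x⟫
  rw [← inner_proj_left, K.proj_of_mem (b k).2]

/-- The diagonal of a tangent vector at `K`, in the systems of the normalized projections of
principal vectors to `K` and to its orthogonal complement, is dominated by the Finsler metric. -/
theorem le_finsler_of_orthogonal {ℓ : (Fin p → ℝ) → ℝ} (hℓ : IsWeylInvariantNorm ℓ) (K : Gr p q)
    (H : Tangent K) {x : Fin p → AmbientSpace p q} (hx : Orthonormal ℝ x)
    (hKx : ∀ i j, i ≠ j → ⟪K.proj (x i), K.proj (x j)⟫ = 0) {d α : Fin p → ℝ}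
    (hd : ∀ j, d j = α j *
      ⟪(H ⟨K.proj (x j), K.proj_mem _⟩ : AmbientSpace p q), x j - K.proj (x j)⟫)
    (hα : ∀ j, |α j| * (‖K.proj (x j)‖ * ‖x j - K.proj (x j)‖) ≤ 1) :
    ℓ d ≤ finsler ℓ K H := by
  let y : Fin p → K.1 := fun j => ⟨K.proj (x j), K.proj_mem _⟩
  let r : Fin p → K.1ᗮ := fun j => ⟨x j - K.proj (x j), K.sub_proj_mem _⟩
  have hy : ∀ i j, i ≠ j → ⟪y i, y j⟫ = 0 := hKx
  have hr : ∀ i j, i ≠ j → ⟪r i, r j⟫ = 0 := by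
    intro i j hij
    change ⟪x i - K.proj (x i), x j - K.proj (x j)⟫ = 0
    have h1 : ⟪K.proj (x i), x j - K.proj (x j)⟫ = 0 := K.sub_proj_mem (x j) _ (K.proj_mem _)
    have h2 : ⟪x i, K.proj (x j)⟫ = 0 := by
      rw [← K.proj_proj, ← inner_proj_left, hKx i j hij]
    rw [inner_sub_left, h1, inner_sub_right, hx.2 hij, h2]
    ring
  exact hℓ.le_singularValues_of_orthogonal K.2 (H : K.1 →ₗ[ℝ] K.1ᗮ) hy hr hd hα

/-! ### First variation of projections and of squared cosines -/

section Derivative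

variable {γ : ℝ → Gr p q} {t : ℝ}

theorem deriv_proj_idem (hγ : DifferentiableAt ℝ (fun s => (γ s).proj) t) (x : AmbientSpace p q) :
    deriv (fun s => (γ s).proj) t ((γ t).proj x)
      + (γ t).proj (deriv (fun s => (γ s).proj) t x) = deriv (fun s => (γ s).proj) t x := by
  have h1 := hγ.hasDerivAt.clm_apply (hγ.hasDerivAt.clm_apply (hasDerivAt_const t x))
  simp only [map_zero, add_zero, proj_proj] at h1
  have h2 := hγ.hasDerivAt.clm_apply (hasDerivAt_const t x)
  rw [map_zero, add_zero] at h2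
  exact h1.unique h2

/-- Differentiating `Π² = Π` gives `Π'Π + ΠΠ' = Π'`; evaluated on the image of `Π`, it leaves no
component of `Π'` along the subspace. -/
theorem proj_deriv_proj (hγ : DifferentiableAt ℝ (fun s => (γ s).proj) t)
    (x : AmbientSpace p q) :
    (γ t).proj (deriv (fun s => (γ s).proj) t ((γ t).proj x)) = 0 := by
  have := deriv_proj_idem hγ ((γ t).proj x)
  rw [proj_proj] at this
  simpa using this

theorem inner_deriv_proj (hγ : DifferentiableAt ℝ (fun s => (γ s).proj) t)
    (x y : AmbientSpace p q) :
    ⟪deriv (fun s => (γ s).proj) t x, y⟫ = ⟪x, deriv (fun s => (γ s).proj) t y⟫ := by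
  have hx := hγ.hasDerivAt.clm_apply (hasDerivAt_const t x)
  have hy := hγ.hasDerivAt.clm_apply (hasDerivAt_const t y)
  rw [map_zero, add_zero] at hx hy
  have h1 := hx.inner ℝ (hasDerivAt_const t y)
  have h2 := (hasDerivAt_const t x).inner ℝ hy
  simp only [inner_zero_left, inner_zero_right, zero_add, add_zero, inner_proj_left] at h1 h2
  exact h1.unique h2

theorem velocity_apply (y : (γ t).1) :
    (velocity γ t y : AmbientSpace p q)
      = deriv (fun s => (γ s).proj) t y - (γ t).proj (deriv (fun s => (γ s).proj) t y) :=
  (γ t).1.starProjection_orthogonal_val _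

theorem velocity_proj (hγ : DifferentiableAt ℝ (fun s => (γ s).proj) t) (x : AmbientSpace p q) :
    (velocity γ t ⟨(γ t).proj x, (γ t).proj_mem x⟩ : AmbientSpace p q)
      = deriv (fun s => (γ s).proj) t ((γ t).proj x) := by
  rw [velocity_apply, proj_deriv_proj hγ, sub_zero]

/-- The first variation of the length of the projection of a fixed vector. -/
theorem hasDerivAt_norm_sq_proj (hγ : DifferentiableAt ℝ (fun s => (γ s).proj) t)
    (x : AmbientSpace p q) :
    HasDerivAt (fun s => ‖(γ s).proj x‖ ^ 2)
      (2 * ⟪(velocity γ t ⟨(γ t).proj x, (γ t).proj_mem x⟩ : AmbientSpace p q),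
        x - (γ t).proj x⟫) t := by
  have hx := hγ.hasDerivAt.clm_apply (hasDerivAt_const t x)
  rw [map_zero, add_zero] at hx
  refine hx.norm_sq.congr_deriv ?_
  rw [velocity_proj hγ, inner_sub_right,
    inner_deriv_proj hγ _ ((γ t).proj x), inner_deriv_proj hγ _ x, inner_proj_left,
    inner_proj_left, proj_deriv_proj hγ, inner_zero_right, sub_zero, real_inner_comm]

/-- At the times where the sums of the squared cosines are differentiable, their derivatives are
given by any system of principal vectors. -/
theorem hasDerivAt_cosAngle_sq (M : Gr p q)
    (hγ : DifferentiableAt ℝ (fun s => (γ s).proj) t)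
    (hd : ∀ j, DifferentiableAt ℝ (fun s => cosAngle (γ s) M j ^ 2) t)
    {u : OrthonormalBasis (Fin p) ℝ (EuclideanSpace ℝ (Fin p))}
    (hu : ∀ i, ‖(γ t).proj (M.frame (u i))‖ = cosAngle (γ t) M i) (j : Fin p) :
    HasDerivAt (fun s => cosAngle (γ s) M j ^ 2)
      (2 * ⟪(velocity γ t ⟨(γ t).proj (M.frame (u j)), (γ t).proj_mem _⟩ : AmbientSpace p q),
        M.frame (u j) - (γ t).proj (M.frame (u j))⟫) t := by
  set β : Fin p → ℝ := fun j =>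
    2 * ⟪(velocity γ t ⟨(γ t).proj (M.frame (u j)), (γ t).proj_mem _⟩ : AmbientSpace p q),
        M.frame (u j) - (γ t).proj (M.frame (u j))⟫ with hβ
  set a : Fin p → ℝ := fun j => deriv (fun s => cosAngle (γ s) M j ^ 2) t with ha
  have hsum : ∀ (m : ℕ) (hm : m ≤ p),
      ∑ i : Fin m, a (Fin.castLE hm i) = ∑ i : Fin m, β (Fin.castLE hm i) := by
    intro m hm
    have h1 : HasDerivAt (fun s => ∑ i : Fin m, cosAngle (γ s) M (Fin.castLE hm i) ^ 2)
        (∑ i : Fin m, a (Fin.castLE hm i)) t :=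
      HasDerivAt.fun_sum fun i _ => (hd _).hasDerivAt
    have h2 : HasDerivAt (fun s => ∑ i : Fin m, ‖(γ s).proj (M.frame (u (Fin.castLE hm i)))‖ ^ 2)
        (∑ i : Fin m, β (Fin.castLE hm i)) t :=
      HasDerivAt.fun_sum fun i _ => hasDerivAt_norm_sq_proj hγ _
    -- By Ky Fan the difference is nonnegative at every `s`, and it vanishes at `s = t` because the
    -- `u i` are principal there. Hence the two derivatives agree.
    have hmin : IsLocalMin (fun s => ∑ i : Fin m, cosAngle (γ s) M (Fin.castLE hm i) ^ 2
        - ∑ i : Fin m, ‖(γ s).proj (M.frame (u (Fin.castLE hm i)))‖ ^ 2) t := by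
      refine Eventually.of_forall fun s => ?_
      simp only [hu, sub_self]
      rw [sub_nonneg]
      refine (LinearMap.sum_norm_sq_le_kyFan
        (((γ s).proj ∘L M.frame : EuclideanSpace ℝ (Fin p) →L[ℝ] AmbientSpace p q) :
          EuclideanSpace ℝ (Fin p) →ₗ[ℝ] AmbientSpace p q)
        (u.orthonormal.comp _ (Fin.castLE_injective hm))).trans (le_of_eq ?_)
      simp only [cosAngle_eq, Fin.val_castLE]
      exact (Fin.sum_univ_eq_sum_range (fun k => (((γ s).proj ∘L M.frame :
        EuclideanSpace ℝ (Fin p) →L[ℝ] AmbientSpace p q) :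
          EuclideanSpace ℝ (Fin p) →ₗ[ℝ] AmbientSpace p q).singularValues k ^ 2) m).symm
    exact sub_eq_zero.mp (hmin.hasDerivAt_eq_zero (h1.sub h2))
  -- Subtracting consecutive partial sums isolates a single index, even when singular values
  -- coincide.
  have hj : a j = β j := by
    have h1 := hsum (j + 1) j.2
    have h0 := hsum j j.2.le
    rw [Fin.sum_univ_castSucc, Fin.sum_univ_castSucc] at h1
    exact add_left_cancel (h1.trans (congrArg (· + _) h0.symm))
  exact (hd j).hasDerivAt.congr_deriv hj

end Derivative

end Gr

/-! ### The regularized angle -/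

/-- A regularization of `κ ↦ arccos √κ`, which is smooth on `[0,1]` for `θ < 1`. -/
noncomputable def regAngle (θ κ : ℝ) : ℝ := Real.arccos (θ * (2 * κ - 1)) / 2

/-- The double-angle formula: `2 arccos x` lies in `[0,π]` and has cosine `2x² - 1`. -/
theorem regAngle_one (x : ℝ) (h0 : 0 ≤ x) (h1 : x ≤ 1) : regAngle 1 (x ^ 2) = Real.arccos x := by
  have hcos : Real.cos (2 * Real.arccos x) = 1 * (2 * x ^ 2 - 1) := by
    rw [Real.cos_two_mul, Real.cos_arccos (by linarith) h1, one_mul]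
  rw [regAngle, ← hcos, Real.arccos_cos (by linarith [Real.arccos_nonneg x])
    (by linarith [Real.arccos_le_pi_div_two.mpr h0])]
  ring

theorem continuous_regAngle (κ : ℝ) : Continuous fun θ => regAngle θ κ :=
  (Real.continuous_arccos.comp (by fun_prop)).div_const 2

section Regularization

variable {θ κ : ℝ}

theorem abs_regAngle_arg_lt (h0 : 0 < θ) (h1 : θ < 1) (hκ : κ ∈ Icc (0 : ℝ) 1) :
    |θ * (2 * κ - 1)| < 1 := by
  rw [abs_mul, abs_of_pos h0]
  have : |2 * κ - 1| ≤ 1 := abs_le.mpr ⟨by linarith [hκ.1], by linarith [hκ.2]⟩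
  nlinarith [abs_nonneg (2 * κ - 1)]

theorem contDiffOn_regAngle (h0 : 0 < θ) (h1 : θ < 1) :
    ContDiffOn ℝ 1 (regAngle θ) (Icc 0 1) := by
  intro κ hκ
  have h := abs_lt.mp (abs_regAngle_arg_lt h0 h1 hκ)
  refine (ContDiffAt.div_const ?_ 2).contDiffWithinAt
  exact ContDiffAt.comp (g := Real.arccos) κ (Real.contDiffAt_arccos h.1.ne' h.2.ne)
    (by fun_prop)

theorem hasDerivAt_regAngle (h0 : 0 < θ) (h1 : θ < 1) (hκ : κ ∈ Icc (0 : ℝ) 1) :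
    HasDerivAt (regAngle θ) (-(θ / √(1 - (θ * (2 * κ - 1)) ^ 2))) κ := by
  have h := abs_lt.mp (abs_regAngle_arg_lt h0 h1 hκ)
  have h2 : HasDerivAt (fun κ : ℝ => θ * (2 * κ - 1)) (θ * 2) κ := by
    simpa using (((hasDerivAt_id κ).const_mul 2).sub_const 1).const_mul θ
  refine (((Real.hasDerivAt_arccos h.1.ne' h.2.ne).comp κ h2).div_const 2).congr_deriv ?_
  ring

/-- With `c = cos φ` and `s = sin φ` this says `θ |sin 2φ| ≤ √(1 - θ² cos² 2φ)` when `cs ≥ 0`, that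
is, `θ² ≤ 1`. The bound `1` is uniform in `θ` and is exactly what normalized diagonal entries allow.
-/
theorem regAngle_deriv_bound (h0 : 0 < θ) (h1 : θ < 1) {c s : ℝ}
    (hcs : c ^ 2 + s ^ 2 = 1) :
    |θ / √(1 - (θ * (2 * c ^ 2 - 1)) ^ 2) * 2| * (c * s) ≤ 1 := by
  have hκ : c ^ 2 ∈ Icc (0 : ℝ) 1 := ⟨sq_nonneg c, by linarith [sq_nonneg s]⟩
  have hpos : 0 < 1 - (θ * (2 * c ^ 2 - 1)) ^ 2 := by
    have := (sq_lt_one_iff_abs_lt_one _).mpr (abs_regAngle_arg_lt h0 h1 hκ)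
    linarith
  have hsq := Real.sqrt_pos.mpr hpos
  rw [abs_of_nonneg (by positivity)]
  have h2 : 2 * θ * (c * s) ≤ √(1 - (θ * (2 * c ^ 2 - 1)) ^ 2) := by
    refine Real.le_sqrt_of_sq_le ?_
    have hs2 : s ^ 2 = 1 - c ^ 2 := by linarith
    have : (2 * θ * (c * s)) ^ 2 = 4 * θ ^ 2 * (c ^ 2 * s ^ 2) := by ring
    rw [this, hs2]
    nlinarith [sq_nonneg θ]
  rw [show θ / √(1 - (θ * (2 * c ^ 2 - 1)) ^ 2) * 2 * (c * s)
    = (2 * θ * (c * s)) / √(1 - (θ * (2 * c ^ 2 - 1)) ^ 2) by ring, div_le_one hsq]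
  exact h2

end Regularization

/-! ### The lower bound: integration along a curve -/

namespace Gr

variable {p q : ℕ}

theorem cosAngle_sq_mem (L M : Gr p q) (j : Fin p) : cosAngle L M j ^ 2 ∈ Icc (0 : ℝ) 1 :=
  ⟨sq_nonneg _, pow_le_one₀ (cosAngle_nonneg L M j) (cosAngle_le_one L M j)⟩

/-- A squared cosine is a difference of two Ky Fan sums, each with Lipschitz constant `2 * p`
because the operators have norm at most one. -/
theorem abs_cosAngle_sq_sub_le (K L M : Gr p q) (j : Fin p) :
    |cosAngle K M j ^ 2 - cosAngle L M j ^ 2| ≤ (4 * p) * ‖K.proj - L.proj‖ := by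
  let T : Gr p q → EuclideanSpace ℝ (Fin p) →L[ℝ] AmbientSpace p q := fun K => K.proj ∘L M.frame
  have hT : ∀ K : Gr p q, ‖T K‖ ≤ 1 := fun K =>
    (ContinuousLinearMap.opNorm_comp_le _ _).trans
      (mul_le_one₀ K.norm_proj_le (norm_nonneg _) M.norm_frame_le)
  have hTT : ‖T K - T L‖ ≤ ‖K.proj - L.proj‖ := by
    have : T K - T L = (K.proj - L.proj) ∘L M.frame := (ContinuousLinearMap.sub_comp _ _ _).symm
    rw [this]
    exact (ContinuousLinearMap.opNorm_comp_le _ _).trans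
      (mul_le_of_le_one_right (norm_nonneg _) M.norm_frame_le)
  have hk : ∀ m ≤ p, |(T K : EuclideanSpace ℝ (Fin p) →ₗ[ℝ] AmbientSpace p q).kyFan m
      - (T L : EuclideanSpace ℝ (Fin p) →ₗ[ℝ] AmbientSpace p q).kyFan m|
      ≤ (2 * p) * ‖K.proj - L.proj‖ := by
    intro m hm
    refine (LinearMap.abs_kyFan_sub_le (T K) (T L) (by simpa using hm)).trans ?_
    have hm' : (m : ℝ) ≤ p := by exact_mod_cast hm
    have h1 : (m : ℝ) * (‖T K‖ + ‖T L‖) ≤ 2 * p := by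
      nlinarith [hT K, hT L, norm_nonneg (T K), norm_nonneg (T L), Nat.cast_nonneg (α := ℝ) m]
    exact mul_le_mul h1 hTT (norm_nonneg _) (by positivity)
  have h1 := hk _ j.2
  have h0 := hk _ j.2.le
  rw [cosAngle_eq, cosAngle_eq, LinearMap.sq_singularValues_eq_kyFan_sub,
    LinearMap.sq_singularValues_eq_kyFan_sub]
  rw [abs_le] at h1 h0 ⊢
  constructor <;> linarith [h1.1, h1.2, h0.1, h0.2]

section Piece

variable {γ : ℝ → Gr p q} {a b : ℝ}

theorem exists_lipschitz_cosAngle_sq (hγ : ContDiffOn ℝ 1 (fun s => (γ s).proj) (Icc a b))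
    (M : Gr p q) (j : Fin p) :
    ∃ C, LipschitzOnWith C (fun s => cosAngle (γ s) M j ^ 2) (Icc a b) := by
  obtain ⟨C, hC⟩ := hγ.exists_lipschitzOnWith one_ne_zero (convex_Icc a b) isCompact_Icc
  refine ⟨4 * p * C, LipschitzOnWith.of_dist_le_mul fun s hs t ht => ?_⟩
  have h1 := hC.dist_le_mul s hs t ht
  rw [dist_eq_norm] at h1
  rw [Real.dist_eq]
  refine (abs_cosAngle_sq_sub_le _ _ M j).trans ?_
  push_cast
  rw [mul_assoc (4 * (p : ℝ))]
  exact mul_le_mul_of_nonneg_left h1 (by positivity)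

theorem absolutelyContinuous_regAngle (hab : a ≤ b)
    (hγ : ContDiffOn ℝ 1 (fun s => (γ s).proj) (Icc a b)) (M : Gr p q) (j : Fin p) {θ : ℝ}
    (h0 : 0 < θ) (h1 : θ < 1) :
    AbsolutelyContinuousOnInterval (fun s => regAngle θ (cosAngle (γ s) M j ^ 2)) a b := by
  obtain ⟨C, hC⟩ := exists_lipschitz_cosAngle_sq hγ M j
  obtain ⟨C', hC'⟩ := (contDiffOn_regAngle h0 h1).exists_lipschitzOnWith one_ne_zero
    (convex_Icc 0 1) isCompact_Icc
  have := hC'.comp hC fun s _ => cosAngle_sq_mem (γ s) M j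
  rw [← uIcc_of_le hab] at this
  exact this.absolutelyContinuousOnInterval

theorem intervalIntegrable_finsler {ℓ : (Fin p → ℝ) → ℝ} (hℓ : IsWeylInvariantNorm ℓ)
    (hab : a < b) (hγ : ContDiffOn ℝ 1 (fun s => (γ s).proj) (Icc a b)) :
    IntervalIntegrable (fun t => finsler ℓ (γ t) (velocity γ t)) MeasureTheory.volume a b := by
  -- The one-sided derivative is continuous up to the endpoints; it agrees with `deriv` in the
  -- interior, which is enough for integrability.
  set D := derivWithin (fun s => (γ s).proj) (Icc a b) with hD
  have hDc : ContinuousOn D (Icc a b) :=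
    hγ.continuousOn_derivWithin (uniqueDiffOn_Icc hab) le_rfl
  have hc : ContinuousOn (fun t => ℓ fun j => (ambient (γ t) (D t) :
      AmbientSpace p q →ₗ[ℝ] AmbientSpace p q).singularValues (Fin.rev j)) (Icc a b) := by
    refine hℓ.continuous.comp_continuousOn (continuousOn_pi.mpr fun j => ?_)
    refine (LinearMap.continuous_singularValues ?_).comp_continuousOn ?_
    · rw [finrank_euclideanSpace_fin]
      exact (Fin.rev j).2.trans_le (Nat.le_add_right p q)
    · exact (continuousOn_const.sub hγ.continuousOn).clm_comp (hDc.clm_comp hγ.continuousOn)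
  rw [← uIcc_of_le hab.le] at hc
  refine hc.intervalIntegrable.congr_uIoo fun t ht => ?_
  rw [uIoo_of_le hab.le] at ht
  have : D t = deriv (fun s => (γ s).proj) t := derivWithin_of_mem_nhds (Icc_mem_nhds ht.1 ht.2)
  simp only [finsler]
  rw [rho_eq_ambient (γ t) (D t) (velocity γ t) fun y => by rw [velocity_apply, this]]

/-- By the chain rule the negative derivatives of the regularized angles are scaled diagonal entries
of the velocity in the systems given by principal vectors at time `t`. The scaling is controlled by
`regAngle_deriv_bound`. -/
theorem ae_sum_deriv_regAngle_le {ℓ : (Fin p → ℝ) → ℝ} (hℓ : IsWeylInvariantNorm ℓ)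
    (hab : a < b) (hγ : ContDiffOn ℝ 1 (fun s => (γ s).proj) (Icc a b)) (M : Gr p q) {θ : ℝ}
    (h0 : 0 < θ) (h1 : θ < 1) {y : Fin p → ℝ} (hy : ∀ x : Fin p → ℝ, ∑ j, y j * x j ≤ ℓ x) :
    ∀ᵐ t, t ∈ Ioo a b →
      ∑ j, y j * -deriv (fun s => regAngle θ (cosAngle (γ s) M j ^ 2)) t
        ≤ finsler ℓ (γ t) (velocity γ t) := by
  have hae : ∀ j, ∀ᵐ t, t ∈ uIcc a b →
      DifferentiableAt ℝ (fun s => cosAngle (γ s) M j ^ 2) t := by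
    intro j
    obtain ⟨C, hC⟩ := exists_lipschitz_cosAngle_sq hγ M j
    rw [← uIcc_of_le hab.le] at hC
    exact hC.absolutelyContinuousOnInterval.ae_differentiableAt
  filter_upwards [MeasureTheory.ae_all_iff.mpr hae] with t hdt ht
  have hd : ∀ j, DifferentiableAt ℝ (fun s => cosAngle (γ s) M j ^ 2) t := fun j =>
    hdt j (by rw [uIcc_of_le hab.le]; exact Ioo_subset_Icc_self ht)
  have hγt : DifferentiableAt ℝ (fun s => (γ s).proj) t :=
    ((hγ.differentiableOn one_ne_zero) t (Ioo_subset_Icc_self ht)).differentiableAt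
      (Icc_mem_nhds ht.1 ht.2)
  obtain ⟨u, hu0, hu1⟩ := exists_principal (γ t) M
  have hderiv := fun j => ((hasDerivAt_regAngle h0 h1 (cosAngle_sq_mem (γ t) M j)).comp t
    (hasDerivAt_cosAngle_sq M hγt hd hu1 j)).deriv
  refine (hy _).trans (le_finsler_of_orthogonal hℓ (γ t) (velocity γ t) (x := fun j => M.frame (u j))
    (α := fun j => θ / √(1 - (θ * (2 * cosAngle (γ t) M j ^ 2 - 1)) ^ 2) * 2) ?_ hu0
    (fun j => ?_) fun j => ?_)
  · rw [orthonormal_iff_ite]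
    intro i j
    rw [inner_frame]
    exact orthonormal_iff_ite.mp u.orthonormal i j
  · have := hderiv j
    simp only [Function.comp_def] at this
    rw [this]
    ring
  · rw [hu1]
    refine regAngle_deriv_bound h0 h1 ?_
    have h3 := (γ t).1.norm_sq_eq_add_norm_sq_starProjection (M.frame (u j))
    rw [norm_frame, u.norm_eq_one, Submodule.starProjection_orthogonal_val] at h3
    rw [← hu1 j]
    change ‖(γ t).1.starProjection _‖ ^ 2 + ‖_ - (γ t).1.starProjection _‖ ^ 2 = 1
    rw [← h3, one_pow]

/-- The regularized angles are absolutely continuous, so the almost everywhere inequality integrates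
by the fundamental theorem of calculus. -/
theorem sum_regAngle_sub_le_integral {ℓ : (Fin p → ℝ) → ℝ} (hℓ : IsWeylInvariantNorm ℓ)
    (hab : a < b) (hγ : ContDiffOn ℝ 1 (fun s => (γ s).proj) (Icc a b)) (M : Gr p q) {θ : ℝ}
    (h0 : 0 < θ) (h1 : θ < 1) {y : Fin p → ℝ} (hy : ∀ x : Fin p → ℝ, ∑ j, y j * x j ≤ ℓ x) :
    ∑ j, y j * regAngle θ (cosAngle (γ a) M j ^ 2) - ∑ j, y j * regAngle θ (cosAngle (γ b) M j ^ 2)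
      ≤ ∫ t in a..b, finsler ℓ (γ t) (velocity γ t) := by
  have hac := fun j => absolutelyContinuous_regAngle hab.le hγ M j h0 h1
  have hint : ∀ j ∈ Finset.univ, IntervalIntegrable
      (fun t => y j * -deriv (fun s => regAngle θ (cosAngle (γ s) M j ^ 2)) t)
      MeasureTheory.volume a b := fun j _ =>
    ((hac j).intervalIntegrable_deriv.neg).const_mul (y j)
  have heq : ∑ j, y j * regAngle θ (cosAngle (γ a) M j ^ 2)
      - ∑ j, y j * regAngle θ (cosAngle (γ b) M j ^ 2)
      = ∫ t in a..b, ∑ j, y j * -deriv (fun s => regAngle θ (cosAngle (γ s) M j ^ 2)) t := by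
    rw [intervalIntegral.integral_finsetSum hint, ← Finset.sum_sub_distrib]
    refine Finset.sum_congr rfl fun j _ => ?_
    rw [intervalIntegral.integral_const_mul, intervalIntegral.integral_neg,
      (hac j).integral_deriv_eq_sub]
    ring
  rw [heq]
  refine intervalIntegral.integral_mono_ae_restrict hab.le
    (by simpa only [Finset.sum_fn] using IntervalIntegrable.sum _ hint)
    (intervalIntegrable_finsler hℓ hab hγ) ?_
  rw [MeasureTheory.restrict_Ioo_eq_restrict_Icc.symm]
  exact (MeasureTheory.ae_restrict_iff' measurableSet_Ioo).mpr
    (ae_sum_deriv_regAngle_le hℓ hab hγ M h0 h1 hy)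

end Piece

/-- The lower bound for the length of a curve. -/
theorem angle_le_finslerLength {ℓ : (Fin p → ℝ) → ℝ} (hℓ : IsWeylInvariantNorm ℓ) (L M : Gr p q)
    {γ : ℝ → Gr p q} (hγ : IsPiecewiseC1Curve γ L M) :
    ℓ (fun j => angle L M j) ≤ finslerLength ℓ γ := by
  obtain ⟨hL, hM, n, τ, hτ, hτ0, hτ1, hC⟩ := hγ
  -- One functional, norming the final answer, serves the whole curve: being linear it commutes with
  -- differentiation, so `ℓ` is never differentiated.
  obtain ⟨y', hyL, hy'⟩ := hℓ.exists_norming fun j => angle L M j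
  set y : Fin p → ℝ := fun j => y' (Pi.single j 1) with hy_def
  have hsum : ∀ x : Fin p → ℝ, ∑ j, y j * x j = y' x := by
    intro x
    conv_rhs => rw [← Finset.univ_sum_single x, map_sum]
    refine Finset.sum_congr rfl fun j _ => ?_
    have : Pi.single j (x j) = x j • (Pi.single j 1 : Fin p → ℝ) := by
      rw [← Pi.single_smul, smul_eq_mul, mul_one]
    rw [this, map_smul, smul_eq_mul, mul_comm]
  have hy : ∀ x : Fin p → ℝ, ∑ j, y j * x j ≤ ℓ x := fun x => (hsum x).trans_le (hy' x)
  have hreg : ∀ θ ∈ Ioo (0 : ℝ) 1, ∑ j, y j * regAngle θ (cosAngle L M j ^ 2)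
      - ∑ j, y j * regAngle θ 1 ≤ finslerLength ℓ γ := by
    intro θ hθ
    -- The differences telescope over the subdivision; integrability is carried along to join
    -- adjacent integrals.
    have key : ∀ i : Fin (n + 1), IntervalIntegrable
        (fun t => finsler ℓ (γ t) (velocity γ t)) MeasureTheory.volume 0 (τ i) ∧
        ∑ j, y j * regAngle θ (cosAngle (γ 0) M j ^ 2)
          - ∑ j, y j * regAngle θ (cosAngle (γ (τ i)) M j ^ 2)
          ≤ ∫ t in (0 : ℝ)..(τ i), finsler ℓ (γ t) (velocity γ t) := by
      intro i
      induction i using Fin.induction with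
      | zero => rw [hτ0]; simp
      | succ i ih =>
        have hlt : τ i.castSucc < τ i.succ := hτ i.castSucc_lt_succ
        have hi := intervalIntegrable_finsler hℓ hlt (hC i)
        refine ⟨ih.1.trans hi, ?_⟩
        rw [← intervalIntegral.integral_add_adjacent_intervals ih.1 hi]
        have h2 := sum_regAngle_sub_le_integral hℓ hlt (hC i) M hθ.1 hθ.2 hy
        linarith [ih.2]
    have hlast := (key (Fin.last n)).2
    rw [hτ1, hL, hM] at hlast
    simp only [cosAngle_self, one_pow] at hlast
    exact hlast
  have hcont : Continuous fun θ => ∑ j, y j * regAngle θ (cosAngle L M j ^ 2)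
      - ∑ j, y j * regAngle θ 1 :=
    (continuous_finsetSum _ fun j _ => continuous_const.mul (continuous_regAngle _)).sub
      (continuous_finsetSum _ fun j _ => continuous_const.mul (continuous_regAngle _))
  -- Only now `θ → 1` from the left. The endpoint term `regAngle θ 1`, which is nonzero for `θ < 1`,
  -- disappears in the limit.
  have hlim := le_of_tendsto (hcont.continuousWithinAt (s := Iio 1) (x := 1)).tendsto
    (by filter_upwards [Ioo_mem_nhdsLT (zero_lt_one (α := ℝ))] with θ hθ using hreg θ hθ)
  have h1 : regAngle 1 1 = 0 := by
    have := regAngle_one 1 zero_le_one le_rfl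
    rwa [one_pow, Real.arccos_one] at this
  have h2 : ∀ j, regAngle 1 (cosAngle L M j ^ 2) = angle L M j := fun j =>
    regAngle_one _ (cosAngle_nonneg L M j) (cosAngle_le_one L M j)
  simp only [h1, h2, mul_zero, Finset.sum_const_zero, sub_zero, hsum] at hlim
  rwa [hyL] at hlim

end Gr

theorem corollary15 (p q : ℕ) (hp : 0 < p) (hpq : p ≤ q) (ℓ : (Fin p → ℝ) → ℝ)
    (hℓ : IsWeylInvariantNorm ℓ) (L M : Gr p q) :
    (Gr.curveLengths ℓ L M).Nonempty ∧
      Gr.geodesicDist ℓ L M = ℓ (fun j => Gr.angle L M j) := by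
  have hmem := Gr.exists_geodesic ℓ L M
  have hle : ∀ r ∈ Gr.curveLengths ℓ L M, ℓ (fun j => Gr.angle L M j) ≤ r := by
    rintro r ⟨γ, hγ, rfl⟩
    exact Gr.angle_le_finslerLength hℓ L M hγ
  exact ⟨⟨_, hmem⟩, le_antisymm (csInf_le ⟨_, hle⟩ hmem) (le_csInf ⟨_, hmem⟩ hle)⟩
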